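/- Let $N\ge 3$. Let $\operatorname{Conf}(N)\subset(\mathbb S^2)^N$ be the space of $N$-tuples $U=(u_1,\dots,u_N)$ of distinct points of the unit sphere $\mathbb S^2\subset\mathbb R^3$, and let $\operatorname{BConf}(N)=\operatorname{Conf}(N)/SO(3)$ with the quotient topology. Write $\theta(u,v)\in[0,\pi]$ for the angle between $u,v\in\mathbb S^2$. For $\theta\ge 0$ let $\operatorname{Conf}(N;\theta)=\{U\in\operatorname{Conf}(N):\theta(u_i,u_j)\ge\theta \text{ for all } i<j\}$, so that $\operatorname{Conf}(N;0)=\operatorname{Conf}(N)$, and let $\operatorname{BConf}(N;\theta)=\operatorname{Conf}(N;\theta)/SO(3)$, regarded as a subspace of $\operatorname{BConf}(N)$ through the map induced by inclusion. The injectivity radius is $\rho(U)=\frac12\min_{i\ne j}\theta(u_i,u_j)$; it is $SO(3)$-invariant and descends to $\operatorname{BConf}(N)$. A configuration $U$ is critical for maximizing $\rho$ if for all $V=(v_1,\dots,v_N)$ with $v_i\in\mathbb R^3$, $v_i\perp u_i$, we have $\max\{\rho(U\# tV)-\rho(U),0\}=o(t)$ as $t\to0$, where $U\# tV=\left(\frac{u_i+tv_i}{|u_i+tv_i|}\right)_{i}$.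 This property is $SO(3)$-invariant; a critical value of $\rho$ on $\operatorname{BConf}(N)$ is the value of $\rho$ at the class of a critical configuration. An $N$-Ring is a configuration whose points are, in some order, $N$ equally spaced points on a great circle. Then the smallest critical value of $\rho$ on $\operatorname{BConf}(N)$ is $\pi/N$. The critical configurations with this value are exactly the $N$-Rings, and any two $N$-Rings differ by a rotation and a permutation of the labels. Moreover, for every real $\theta$ with $0\le\theta<2\pi/N$: (1) $\operatorname{Conf}(N;\theta)$ is a strong deformation retract of $\operatorname{Conf}(N)$; (2) $\operatorname{BConf}(N;\theta)$ is a strong deformation retract of $\operatorname{BConf}(N)$ (in particular the natural map $\operatorname{BConf}(N;\theta)\to\operatorname{BConf}(N)$ is a topological embedding). Consequently the inclusions $\operatorname{Conf}(N;\theta)\to\operatorname{Conf}(N)$ and $\operatorname{BConf}(N;\theta)\to\operatorname{BConf}(N)$ are homotopy equivalences and induce isomorphisms on singular cohomology groups in all degrees, with coefficients in any abelian group. -/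

import Mathlib

open scoped Topology

/-- Euclidean 3-space. -/
abbrev E3 : Type := EuclideanSpace ℝ (Fin 3)

/-- The unit 2-sphere in Euclidean 3-space. -/
abbrev S2 : Type := Metric.sphere (0 : E3) 1

/-- The rotation group `SO(3)`. -/
abbrev SO3 : Type := Matrix.specialOrthogonalGroup (Fin 3) ℝ

/-! ### Rotations of the sphere -/

/-- The linear action of a rotation matrix on Euclidean 3-space. -/
noncomputable def rot (A : SO3) : E3 →ₗ[ℝ] E3 := Matrix.toEuclideanLin A.1

theorem rot_one (x : E3) : rot 1 x = x := by
  simp [rot]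

theorem rot_mul (A B : SO3) (x : E3) : rot (A * B) x = rot A (rot B x) := by
  simp [rot, Matrix.toLpLin_apply, Matrix.mulVec_mulVec]

theorem rot_rot_inv (A : SO3) (x : E3) : rot A (rot A⁻¹ x) = x := by
  rw [← rot_mul, mul_inv_cancel, rot_one]

theorem rot_inv_rot (A : SO3) (x : E3) : rot A⁻¹ (rot A x) = x := by
  rw [← rot_mul, inv_mul_cancel, rot_one]

theorem inner_rot (A : SO3) (x y : E3) : inner ℝ (rot A x) (rot A y) = inner ℝ x y := by
  have hA : A.1.transpose * A.1 = 1 :=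
    (Matrix.mem_orthogonalGroup_iff' _ _).1 (Matrix.mem_specialOrthogonalGroup_iff.1 A.2).1
  simp only [rot, Matrix.toLpLin_apply, EuclideanSpace.inner_eq_star_dotProduct, star_trivial]
  rw [Matrix.dotProduct_mulVec, ← Matrix.mulVec_transpose, Matrix.mulVec_mulVec, hA,
    Matrix.one_mulVec]

theorem norm_rot (A : SO3) (x : E3) : ‖rot A x‖ = ‖x‖ := by
  rw [@norm_eq_sqrt_real_inner _ _ _ (rot A x), inner_rot, ← norm_eq_sqrt_real_inner]

theorem angle_rot (A : SO3) (x y : E3) :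
    InnerProductGeometry.angle (rot A x) (rot A y) = InnerProductGeometry.angle x y := by
  simp only [InnerProductGeometry.angle, inner_rot, norm_rot]

theorem rot_injective (A : SO3) : Function.Injective (rot A) := fun x y h => by
  rw [← rot_inv_rot A x, h, rot_inv_rot]

/-- Rotations act on the unit sphere. -/
noncomputable instance : MulAction SO3 S2 where
  smul A p := ⟨rot A p, by simp [norm_rot]⟩
  one_smul p := Subtype.ext (rot_one p)
  mul_smul A B p := Subtype.ext (rot_mul A B p)

theorem coe_smul_S2 (A : SO3) (p : S2) : ((A • p : S2) : E3) = rot A p := rfl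

/-! ### Configuration spaces -/

/-- The configuration space of `N` distinct labeled points on the unit sphere, with the
subspace topology of the `N`-fold product of spheres. -/
def Conf (N : ℕ) : Type := {u : Fin N → S2 // Function.Injective u}

instance (N : ℕ) : TopologicalSpace (Conf N) :=
  inferInstanceAs (TopologicalSpace {u : Fin N → S2 // Function.Injective u})

/-- The underlying tuple of vectors in Euclidean 3-space. -/
def Conf.vec {N : ℕ} (U : Conf N) : Fin N → E3 := fun i => (U.1 i : E3)

/-- Rotations act diagonally on configurations. -/
noncomputable instance (N : ℕ) : MulAction SO3 (Conf N) where
  smul A U := ⟨fun i => A • U.1 i, (MulAction.injective A).comp U.2⟩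
  one_smul U := Subtype.ext (funext fun i => one_smul SO3 (U.1 i))
  mul_smul A B U := Subtype.ext (funext fun i => mul_smul A B (U.1 i))

theorem Conf.vec_smul {N : ℕ} (A : SO3) (U : Conf N) (i : Fin N) :
    (A • U).vec i = rot A (U.vec i) := rfl

/-- The configuration obtained from `U` by permuting the labels. -/
def Conf.relabel {N : ℕ} (U : Conf N) (σ : Equiv.Perm (Fin N)) : Conf N :=
  ⟨U.1 ∘ σ, U.2.comp σ.injective⟩

/-- The reduced configuration space `Conf N / SO(3)`, with the quotient topology. -/
abbrev BConf (N : ℕ) : Type := MulAction.orbitRel.Quotient SO3 (Conf N)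

/-- The class of a configuration up to rotation. -/
noncomputable def BConf.mk {N : ℕ} (U : Conf N) : BConf N := Quotient.mk (MulAction.orbitRel SO3 (Conf N)) U

/-- The constrained configuration space: configurations whose points are pairwise at angular
distance at least `θ`. -/
def ConfAngle (N : ℕ) (θ : ℝ) : Type :=
  {U : Conf N // ∀ i j : Fin N, i < j → θ ≤ InnerProductGeometry.angle (U.vec i) (U.vec j)}

instance (N : ℕ) (θ : ℝ) : TopologicalSpace (ConfAngle N θ) :=
  inferInstanceAs (TopologicalSpace
    {U : Conf N // ∀ i j : Fin N, i < j → θ ≤ InnerProductGeometry.angle (U.vec i) (U.vec j)})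

noncomputable instance (N : ℕ) (θ : ℝ) : MulAction SO3 (ConfAngle N θ) where
  smul A U := ⟨A • U.1, fun i j hij => by
    rw [Conf.vec_smul, Conf.vec_smul, angle_rot]; exact U.2 i j hij⟩
  one_smul U := Subtype.ext (one_smul SO3 U.1)
  mul_smul A B U := Subtype.ext (mul_smul A B U.1)

/-- The reduced constrained configuration space `ConfAngle N θ / SO(3)`, with the quotient
topology. -/
abbrev BConfAngle (N : ℕ) (θ : ℝ) : Type := MulAction.orbitRel.Quotient SO3 (ConfAngle N θ)

/-- The inclusion of the constrained configuration space in the full one. -/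
def ConfAngle.incl (N : ℕ) (θ : ℝ) : C(ConfAngle N θ, Conf N) := ⟨Subtype.val, continuous_subtype_val⟩

/-- The natural map between the reduced spaces, induced by the inclusion. -/
noncomputable def BConfAngle.incl (N : ℕ) (θ : ℝ) : C(BConfAngle N θ, BConf N) where
  toFun := Quotient.map (sa := MulAction.orbitRel SO3 (ConfAngle N θ))
    (sb := MulAction.orbitRel SO3 (Conf N)) (ConfAngle.incl N θ) (by
      rintro U W ⟨A, rfl⟩
      exact ⟨A, rfl⟩)
  continuous_toFun := Continuous.quotient_map' (s := MulAction.orbitRel SO3 (ConfAngle N θ))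
    (t := MulAction.orbitRel SO3 (Conf N)) (ConfAngle.incl N θ).continuous _

/-! ### The injectivity radius and its critical configurations -/

/-- Half of the minimal angle between two distinct entries of a tuple of vectors. For `N ≥ 2` this
is an infimum over a finite nonempty index set, hence a minimum. -/
noncomputable def injRadius {N : ℕ} (u : Fin N → E3) : ℝ :=
  (1 / 2) * ⨅ p : {p : Fin N × Fin N // p.1 ≠ p.2}, InnerProductGeometry.angle (u p.1.1) (u p.1.2)

theorem injRadius_rot {N : ℕ} (A : SO3) (u : Fin N → E3) :
    injRadius (fun i => rot A (u i)) = injRadius u := by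
  simp only [injRadius, angle_rot]

/-- The injectivity radius function on configurations. -/
noncomputable def Conf.rho {N : ℕ} (U : Conf N) : ℝ := injRadius U.vec

/-- The injectivity radius function on the reduced configuration space. -/
noncomputable def BConf.rho {N : ℕ} (x : BConf N) : ℝ :=
  Quotient.lift (s := MulAction.orbitRel SO3 (Conf N)) Conf.rho (by
    rintro U W ⟨A, rfl⟩
    exact injRadius_rot A W.vec) x

/-- `v` is a tangent vector to the product of spheres (hence to `Conf N`) at `u`. -/
def IsTangent {N : ℕ} (u v : Fin N → E3) : Prop := ∀ i, inner ℝ (u i) (v i) = 0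

/-- The variation `u # t v`: translate every `u i` by `t • v i` and project radially back to the
unit sphere. -/
noncomputable def vary {N : ℕ} (u v : Fin N → E3) (t : ℝ) : Fin N → E3 :=
  fun i => ‖u i + t • v i‖⁻¹ • (u i + t • v i)

/-- `U` is critical for maximizing `rho`: no tangent variation increases `rho` to first order. -/
def Conf.IsCritical {N : ℕ} (U : Conf N) : Prop :=
  ∀ v : Fin N → E3, IsTangent U.vec v →
    (fun t : ℝ => max (injRadius (vary U.vec v t) - U.rho) 0) =o[𝓝 0] fun t : ℝ => t

theorem vary_rot {N : ℕ} (A : SO3) (u v : Fin N → E3) (t : ℝ) :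
    vary (fun i => rot A (u i)) (fun i => rot A (v i)) t = fun i => rot A (vary u v t i) := by
  funext i
  simp only [vary, ← map_smul, ← map_add, norm_rot]

theorem Conf.IsCritical.smul {N : ℕ} {U : Conf N} (h : U.IsCritical) (A : SO3) :
    (A • U).IsCritical := by
  intro v hv
  have hv' : IsTangent U.vec (fun i => rot A⁻¹ (v i)) := fun i => by
    rw [← inner_rot A, rot_rot_inv]; exact hv i
  have key := h _ hv'
  have e : ∀ t, injRadius (vary (A • U).vec v t)
      = injRadius (vary U.vec (fun i => rot A⁻¹ (v i)) t) := fun t => by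
    rw [← injRadius_rot A (vary U.vec _ t), ← vary_rot]
    simp only [rot_rot_inv]
    rfl
  have e' : (A • U).rho = U.rho := injRadius_rot A U.vec
  simpa only [e, e'] using key

/-- Criticality is invariant under rotations, so it makes sense on the reduced space. -/
def BConf.IsCritical {N : ℕ} (x : BConf N) : Prop :=
  Quotient.lift (s := MulAction.orbitRel SO3 (Conf N)) Conf.IsCritical (by
    rintro U W ⟨A, rfl⟩
    refine propext ⟨fun h => ?_, fun h => h.smul A⟩
    have := Conf.IsCritical.smul h A⁻¹
    rwa [inv_smul_smul] at this) x

/-- A critical value of `rho` on the reduced configuration space. -/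
def IsCriticalValue (N : ℕ) (c : ℝ) : Prop := ∃ x : BConf N, x.IsCritical ∧ x.rho = c

/-- `U` is an `N`-ring: its points are, in some order, `N` equally spaced points along a great
circle (the unit circle of the plane spanned by the orthonormal vectors `e` and `f`). -/
def Conf.IsNRing {N : ℕ} (U : Conf N) : Prop :=
  ∃ e f : E3, ‖e‖ = 1 ∧ ‖f‖ = 1 ∧ inner ℝ e f = 0 ∧ ∃ σ : Equiv.Perm (Fin N), ∀ k : Fin N,
    U.vec (σ k) = Real.cos (2 * Real.pi * k / N) • e + Real.sin (2 * Real.pi * k / N) • f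

/-! ### Strong deformation retracts and cohomology -/

/-- The map `i : A → X` identifies `A` with a strong deformation retract of `X`: it is a
topological embedding, and there is a homotopy of self-maps of `X`, from the identity to a map
with values in the image of `A`, which fixes every point of the image of `A` at all times. -/
def IsStrongDeformationRetract {A X : Type*} [TopologicalSpace A] [TopologicalSpace X]
    (i : C(A, X)) : Prop :=
  Topology.IsEmbedding i ∧ ∃ H : C(unitInterval × X, X), (∀ x, H (0, x) = x) ∧ (∀ x, H (1, x) ∈ Set.range i) ∧
    ∀ t a, H (t, i a) = i a

/-- `i` is a homotopy equivalence. -/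
def IsHomotopyEquivalence {A X : Type*} [TopologicalSpace A] [TopologicalSpace X]
    (i : C(A, X)) : Prop :=
  ∃ e : ContinuousMap.HomotopyEquiv A X, e.toFun = i

open CategoryTheory AlgebraicTopology in
/-- Singular cohomology in degree `k` with coefficients in the abelian group `M`: the cohomology
of the cochain complex `Hom(C_•(X; ℤ), M)`, where `C_•(X; ℤ)` is the singular chain complex. -/
noncomputable def singularCohomology (M : AddCommGrpCat.{0}) (k : ℕ) :
    TopCat.{0}ᵒᵖ ⥤ AddCommGrpCat.{0} :=
  ((singularChainComplexFunctor AddCommGrpCat.{0}).obj (AddCommGrpCat.of ℤ)).op ⋙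
    HomologicalComplex.opFunctor AddCommGrpCat.{0} (ComplexShape.down ℕ) ⋙
    (preadditiveYoneda.obj M).mapHomologicalComplex (ComplexShape.down ℕ).symm ⋙
    HomologicalComplex.homologyFunctor AddCommGrpCat.{0} (ComplexShape.down ℕ).symm k

open CategoryTheory in
/-- `i` induces isomorphisms on all singular cohomology groups, for all coefficient groups. -/
def InducesIsoOnCohomology {A X : Type} [TopologicalSpace A] [TopologicalSpace X]
    (i : C(A, X)) : Prop :=
  ∀ (M : AddCommGrpCat.{0}) (k : ℕ), IsIso ((singularCohomology M k).map (TopCat.ofHom i).op)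

/-!
A configuration is critical for `ρ` only if its contact graph (the pairs at the smallest angle `ℓ`)
carries a nonzero equilibrium stress: otherwise, by Gordan's alternative, a tangent vector increases
all the smallest angles to first order (`exists_expanding_of_no_stress`,
`Conf.IsCritical.exists_stress`). The heart of the proof is `IsStress.eq_ring`: a nonzero stress
forces `N ℓ ≥ 2π`, with equality for rings only.

* Among the nonzero stresses take one with a minimal set of stressed vertices. Its graph has no cut
  vertex, since at a cut vertex the vanishing of the total torque splits the stress in two
  (`IsStress.balanced_of_separates`). Hence any two of its edges lie on a common simple cycle
  (`IsMinimalStress.exists_path`).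
* Drawn on the sphere, the graph meets its antipodal image (`exists_antipodal`). If it did not, take
  a shortest geodesic from the antipodal image to the graph. The balance of the tensions and the
  first variation provide directions of the two graphs at its ends that are orthogonal to it and can
  be taken parallel to each other. Moving along both shortens the geodesic, because the sphere is
  positively curved.
* A simple cycle of edges through two antipodal points has length at least `2π` and at most `N ℓ`
  (`polygon_angles`). In the case of equality all angles from the antipodal point grow at full
  speed, which puts the vertices on great semicircles; the balance at a vertex makes these fit
  together (`IsStress.eq_ring_of_path`).

Rings are critical because, to first order, the sum of the inner products of neighbours is constant
(`Conf.IsNRing.isCritical`).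

For the deformation retraction, a configuration whose smallest angle is below `2π / N` has no
stress, so its smallest angles can be increased. The coefficients of an increasing tangent field,
written as a combination of the points, range over a convex set that depends on the Gram matrix
only. A partition of unity on the space of Gram matrices yields a continuous field, which is
equivariant because the Gram matrix is invariant (`exists_expanding_field`). Following it for time
one, with a cut-off at the angle `θ`, and repeating this infinitely often
(`exists_homotopy_of_iterates`) moves every configuration into `Conf(N; θ)` after finitely many
steps, locally uniformly by compactness (`exists_iterate_mu_le`). By equivariance the homotopy
descends to the orbit spaces (`exists_orbit_homotopy`). Homotopy invariance of the singular chain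
complex gives the statement about cohomology.
-/

/-! ### Homotopy equivalences, cohomology and orbit spaces -/

open CategoryTheory AlgebraicTopology in
theorem singularCohomology_map_eq_of_homotopy {X Y : TopCat.{0}} {f g : X ⟶ Y}
    (H : TopCat.Homotopy f g) (M : AddCommGrpCat.{0}) (k : ℕ) :
    (singularCohomology M k).map f.op = (singularCohomology M k).map g.op :=
  ((preadditiveYoneda.obj M).mapHomotopy
    (H.singularChainComplexFunctorObjMap (AddCommGrpCat.of ℤ)).op).homologyMap_eq k

open CategoryTheory in
theorem IsHomotopyEquivalence.inducesIsoOnCohomology {A X : Type} [TopologicalSpace A]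
    [TopologicalSpace X] {i : C(A, X)} (h : IsHomotopyEquivalence i) :
    InducesIsoOnCohomology i := by
  obtain ⟨e, rfl⟩ := h
  intro M k
  have hl : TopCat.ofHom e.toFun ≫ TopCat.ofHom e.invFun = TopCat.ofHom (e.invFun.comp e.toFun) :=
    rfl
  have hr : TopCat.ofHom e.invFun ≫ TopCat.ofHom e.toFun = TopCat.ofHom (e.toFun.comp e.invFun) :=
    rfl
  refine ⟨(singularCohomology M k).map (TopCat.ofHom e.invFun).op, ?_, ?_⟩
  · rw [← Functor.map_comp, ← op_comp, hr]
    refine Eq.trans ?_ ((singularCohomology M k).map_id _)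
    exact singularCohomology_map_eq_of_homotopy
      (f := TopCat.ofHom (e.toFun.comp e.invFun)) (g := 𝟙 _) e.right_inv.some M k
  · rw [← Functor.map_comp, ← op_comp, hl]
    refine Eq.trans ?_ ((singularCohomology M k).map_id _)
    exact singularCohomology_map_eq_of_homotopy
      (f := TopCat.ofHom (e.invFun.comp e.toFun)) (g := 𝟙 _) e.left_inv.some M k

theorem IsStrongDeformationRetract.isHomotopyEquivalence {A X : Type*} [TopologicalSpace A]
    [TopologicalSpace X] {i : C(A, X)} (h : IsStrongDeformationRetract i) :
    IsHomotopyEquivalence i := by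
  obtain ⟨hi, H, H0, H1, Hfix⟩ := h
  choose r hr using H1
  have hrc : Continuous r := by
    rw [hi.continuous_iff]
    have : i ∘ r = fun x => H (1, x) := funext hr
    rw [this]
    fun_prop
  have hri : ∀ a, r (i a) = a := fun a => hi.injective (by rw [hr, Hfix])
  refine ⟨⟨i, ⟨r, hrc⟩, ?_, ?_⟩, rfl⟩
  · have : (ContinuousMap.mk r hrc).comp i = ContinuousMap.id A := ContinuousMap.ext hri
    rw [this]
  · refine ContinuousMap.Homotopic.symm ⟨⟨H, fun x => ?_, fun x => ?_⟩⟩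
    · exact H0 x
    · exact (hr x).symm

/-- An equivariant homotopy descends to the orbit space, because the product of the identity of the
interval with the (open) orbit map is again a quotient map. -/
theorem exists_orbit_homotopy {G X : Type*} [Group G] [TopologicalSpace X] [MulAction G X]
    [ContinuousConstSMul G X] (H : C(unitInterval × X, X))
    (hH : ∀ t (g : G) x, H (t, g • x) = g • H (t, x)) :
    ∃ K : C(unitInterval × MulAction.orbitRel.Quotient G X, MulAction.orbitRel.Quotient G X),
      ∀ t x, K (t, Quotient.mk (MulAction.orbitRel G X) x) =
        Quotient.mk (MulAction.orbitRel G X) (H (t, x)) := by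
  let := MulAction.orbitRel G X
  have hq : IsOpenQuotientMap (Quotient.mk (MulAction.orbitRel G X)) :=
    ⟨Quotient.mk_surjective, continuous_quotient_mk', isOpenMap_quotient_mk'_mul⟩
  let K : unitInterval × MulAction.orbitRel.Quotient G X → MulAction.orbitRel.Quotient G X :=
    fun p => Quotient.map (sa := MulAction.orbitRel G X) (sb := MulAction.orbitRel G X)
      (fun x => H (p.1, x)) (by rintro x y ⟨g, rfl⟩; exact ⟨g, (hH _ _ _).symm⟩) p.2
  refine ⟨⟨K, ?_⟩, fun t x => rfl⟩
  have hq2 := (IsOpenQuotientMap.id (X := unitInterval)).prodMap hq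
  rw [hq2.isQuotientMap.continuous_iff]
  exact hq.continuous.comp H.continuous

/-! ### Infinite concatenation of a deformation that lands in finitely many steps -/

/-- The clock of the `n`-th step: a ramp from `0` to `1` which is `0` up to time `n / (n + 1)` and
`1` from time `(n + 1) / (n + 2)` on. -/
noncomputable def stepClock (n : ℕ) (t : unitInterval) : unitInterval :=
  Set.projIcc 0 1 zero_le_one ((n + 2) * ((n + 1) * (t : ℝ) - n))

theorem continuous_stepClock (n : ℕ) : Continuous (stepClock n) := by
  unfold stepClock
  fun_prop

theorem stepClock_eq_zero {n : ℕ} {t : unitInterval} (h : (n + 1) * (t : ℝ) ≤ n) :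
    stepClock n t = 0 :=
  Set.projIcc_of_le_left _ (mul_nonpos_of_nonneg_of_nonpos (by positivity) (by linarith))

theorem stepClock_eq_one {m n : ℕ} (hmn : m < n) {t : unitInterval} (h : n < (n + 1) * (t : ℝ)) :
    stepClock m t = 1 := by
  refine Set.projIcc_of_right_le _ ?_
  have hmn' : (m : ℝ) + 1 ≤ n := by exact_mod_cast hmn
  have ht : (m + 1 : ℝ) ≤ (m + 2) * t := by
    have h1 : (t : ℝ) ≤ 1 := t.2.2
    nlinarith [mul_nonneg (sub_nonneg.2 hmn') (sub_nonneg.2 h1)]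
  nlinarith

theorem stepClock_zero (n : ℕ) : stepClock n 0 = 0 := stepClock_eq_zero (by simp)

theorem stepClock_one (n : ℕ) : stepClock n 1 = 1 :=
  Set.projIcc_of_right_le _ (by push_cast; nlinarith [(Nat.cast_nonneg n : (0 : ℝ) ≤ n)])

/-- The first `n` steps of the iterated deformation `h`, step `m` following the clock
`stepClock m`. -/
noncomputable def iterateSteps {X : Type*} (h : unitInterval × X → X) :
    ℕ → unitInterval × X → X
  | 0, p => p.2
  | n + 1, p => h (stepClock n p.1, iterateSteps h n p)

section iterateSteps

variable {X : Type*} {h : unitInterval × X → X}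

theorem continuous_iterateSteps [TopologicalSpace X] (hc : Continuous h) (n : ℕ) :
    Continuous (iterateSteps h n) := by
  induction n with
  | zero => exact continuous_snd
  | succ n ih => exact hc.comp (((continuous_stepClock n).comp continuous_fst).prodMk ih)

theorem iterateSteps_eq_iterate {n : ℕ} {t : unitInterval} (ht : ∀ m < n, stepClock m t = 1)
    (x : X) : iterateSteps h n (t, x) = (fun y => h (1, y))^[n] x := by
  induction n with
  | zero => rfl
  | succ n ih =>
    rw [Function.iterate_succ_apply', ← ih fun m hm => ht m (by omega)]
    simp only [iterateSteps, ht n (by omega)]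

theorem iterateSteps_zero (h0 : ∀ x, h (0, x) = x) (n : ℕ) (x : X) :
    iterateSteps h n (0, x) = x := by
  induction n with
  | zero => rfl
  | succ n ih => simp only [iterateSteps, stepClock_zero, h0, ih]

theorem iterateSteps_of_mem {S : Set X} (hS : ∀ t, ∀ x ∈ S, h (t, x) = x) (n : ℕ)
    (t : unitInterval) {x : X} (hx : x ∈ S) : iterateSteps h n (t, x) = x := by
  induction n with
  | zero => rfl
  | succ n ih => simp only [iterateSteps, ih, hS _ x hx]

theorem iterateSteps_commute {g : X → X} (hg : ∀ t x, h (t, g x) = g (h (t, x))) (n : ℕ)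
    (t : unitInterval) (x : X) : iterateSteps h n (t, g x) = g (iterateSteps h n (t, x)) := by
  induction n with
  | zero => rfl
  | succ n ih => simp only [iterateSteps, ih, hg]

/-- Once `n` full steps bring `x` into `S`, later steps have no effect at any time: a step later
than `n` has either not started, or all the earlier ones are finished. -/
theorem iterateSteps_stable {S : Set X} (h0 : ∀ x, h (0, x) = x)
    (hS : ∀ t, ∀ x ∈ S, h (t, x) = x) {n : ℕ} {x : X} (hx : (fun y => h (1, y))^[n] x ∈ S)
    {m : ℕ} (hm : n ≤ m) (t : unitInterval) :
    iterateSteps h m (t, x) = iterateSteps h n (t, x) := by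
  have hit : ∀ k, n ≤ k → (fun y => h (1, y))^[k] x ∈ S := by
    intro k hk
    induction k, hk using Nat.le_induction with
    | base => exact hx
    | succ k _ ih => rwa [Function.iterate_succ_apply', hS _ _ ih]
  induction m, hm using Nat.le_induction with
  | base => rfl
  | succ m hm ih =>
    rw [← ih]
    change h (stepClock m t, _) = _
    rcases le_or_gt ((m + 1) * (t : ℝ)) m with ht | ht
    · rw [stepClock_eq_zero ht, h0]
    · refine hS _ _ ?_
      rw [iterateSteps_eq_iterate fun k hk => stepClock_eq_one hk ht]
      exact hit m hm

end iterateSteps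

/-- A homotopy `h` from the identity, fixing `S`, whose end map brings every point into `S` after
finitely many (locally boundedly many) iterations, can be concatenated infinitely often to a
homotopy that ends in `S`. It commutes with all maps that `h` commutes with. -/
theorem exists_homotopy_of_iterates {X : Type*} [TopologicalSpace X] (h : C(unitInterval × X, X))
    (S : Set X) (h0 : ∀ x, h (0, x) = x) (hS : ∀ t, ∀ x ∈ S, h (t, x) = x)
    (hland : ∀ x, ∃ n : ℕ, ∀ᶠ y in 𝓝 x, (fun y => h (1, y))^[n] y ∈ S) :
    ∃ H : C(unitInterval × X, X), (∀ x, H (0, x) = x) ∧ (∀ x, H (1, x) ∈ S) ∧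
      (∀ t, ∀ x ∈ S, H (t, x) = x) ∧
      ∀ g : X → X, (∀ t x, h (t, g x) = g (h (t, x))) → ∀ t x, H (t, g x) = g (H (t, x)) := by
  choose n hn using hland
  have hstab : ∀ x, ∀ᶠ y in 𝓝 x, ∀ m, n x ≤ m → ∀ t,
      iterateSteps h m (t, y) = iterateSteps h (n x) (t, y) := fun x =>
    (hn x).mono fun y hy m hm t => iterateSteps_stable h0 hS hy hm t
  let H : unitInterval × X → X := fun p => iterateSteps h (n p.2) p
  have hH : ∀ x, ∀ᶠ y in 𝓝 x, ∀ t, H (t, y) = iterateSteps h (n x) (t, y) := fun x =>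
    (hstab x).mono fun y hy t => by
      rw [← hy _ (le_max_left _ _) t]
      exact ((hstab y).self_of_nhds _ (le_max_right _ _) t).symm
  refine ⟨⟨H, ?_⟩, fun x => iterateSteps_zero h0 _ x, fun x => ?_, fun t x hx =>
    iterateSteps_of_mem hS _ t hx, fun g hg t x => ?_⟩
  · refine continuous_iff_continuousAt.2 fun p => ?_
    have : H =ᶠ[𝓝 p] iterateSteps h (n p.2) :=
      (continuous_snd.continuousAt.eventually (hH p.2)).mono fun q hq => hq q.1
    exact (continuous_iterateSteps h.continuous _).continuousAt.congr this.symm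
  · change iterateSteps h (n x) (1, x) ∈ S
    rw [iterateSteps_eq_iterate fun m _ => stepClock_one m]
    exact (hn x).self_of_nhds
  · change iterateSteps h _ (t, g x) = g (iterateSteps h _ (t, x))
    rw [← (hstab (g x)).self_of_nhds _ (le_max_left _ (n x)) t,
      ← (hstab x).self_of_nhds _ (le_max_right (n (g x)) _) t, iterateSteps_commute hg]

/-! ### Inner products, first variation and stresses -/

/-- The largest off-diagonal entry of a square array. For the Gram matrix of a tuple of unit vectors
this is the cosine of the smallest angle, see `injRadius_eq`. -/
noncomputable def maxOffDiag {N : ℕ} (M : Fin N → Fin N → ℝ) : ℝ :=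
  ⨆ p : {p : Fin N × Fin N // p.1 ≠ p.2}, M p.1.1 p.1.2

/-- The array of inner products of a tuple of vectors. -/
noncomputable def gramArray {N : ℕ} (u : Fin N → E3) (i j : Fin N) : ℝ := inner ℝ (u i) (u j)

theorem le_maxOffDiag {N : ℕ} (M : Fin N → Fin N → ℝ) {i j : Fin N} (hij : i ≠ j) :
    M i j ≤ maxOffDiag M :=
  le_ciSup (f := fun p : {p : Fin N × Fin N // p.1 ≠ p.2} => M p.1.1 p.1.2)
    (Set.finite_range _).bddAbove ⟨(i, j), hij⟩

theorem nonempty_offDiag {N : ℕ} (hN : 2 ≤ N) : Nonempty {p : Fin N × Fin N // p.1 ≠ p.2} :=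
  ⟨⟨(⟨0, by omega⟩, ⟨1, by omega⟩), by simp⟩⟩

theorem exists_eq_maxOffDiag {N : ℕ} (hN : 2 ≤ N) (M : Fin N → Fin N → ℝ) :
    ∃ i j, i ≠ j ∧ M i j = maxOffDiag M := by
  have := nonempty_offDiag hN
  obtain ⟨p, hp⟩ := exists_eq_ciSup_of_finite
    (f := fun p : {p : Fin N × Fin N // p.1 ≠ p.2} => M p.1.1 p.1.2)
  exact ⟨p.1.1, p.1.2, p.2, hp⟩

theorem maxOffDiag_le {N : ℕ} (hN : 2 ≤ N) {M : Fin N → Fin N → ℝ} {c : ℝ}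
    (h : ∀ i j, i ≠ j → M i j ≤ c) : maxOffDiag M ≤ c := by
  obtain ⟨i, j, hij, e⟩ := exists_eq_maxOffDiag hN M
  exact e ▸ h i j hij

theorem continuous_maxOffDiag {N : ℕ} (hN : 2 ≤ N) :
    Continuous (maxOffDiag : (Fin N → Fin N → ℝ) → ℝ) := by
  have := nonempty_offDiag hN
  unfold maxOffDiag
  simp_rw [← Finset.sup'_univ_eq_ciSup]
  exact Continuous.finset_sup'_apply _ fun p _ => by fun_prop

theorem injRadius_eq {N : ℕ} (hN : 2 ≤ N) {u : Fin N → E3} (hu : ∀ i, ‖u i‖ = 1) :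
    injRadius u = 1 / 2 * Real.arccos (maxOffDiag (gramArray u)) := by
  have := nonempty_offDiag hN
  have ha : ∀ i j, InnerProductGeometry.angle (u i) (u j) = Real.arccos (gramArray u i j) :=
    fun i j => by simp [InnerProductGeometry.angle, hu, gramArray]
  unfold injRadius
  congr 1
  simp only [ha]
  obtain ⟨i, j, hij, e⟩ := exists_eq_maxOffDiag hN (gramArray u)
  refine le_antisymm ?_ (le_ciInf fun p => Real.arccos_le_arccos (le_maxOffDiag _ p.2))
  rw [← e]
  exact ciInf_le (f := fun p : {p : Fin N × Fin N // p.1 ≠ p.2} =>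
    Real.arccos (gramArray u p.1.1 p.1.2)) (Set.finite_range _).bddBelow ⟨(i, j), hij⟩

theorem gramArray_le_one {N : ℕ} {u : Fin N → E3} (hu : ∀ i, ‖u i‖ = 1) (i j : Fin N) :
    gramArray u i j ≤ 1 := by
  simpa [hu, gramArray] using real_inner_le_norm (u i) (u j)

theorem neg_one_le_gramArray {N : ℕ} {u : Fin N → E3} (hu : ∀ i, ‖u i‖ = 1) (i j : Fin N) :
    -1 ≤ gramArray u i j := by
  have := (abs_le.1 (abs_real_inner_le_norm (u i) (u j))).1
  simpa [hu, gramArray] using this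

theorem maxOffDiag_mem_Icc {N : ℕ} (hN : 2 ≤ N) {u : Fin N → E3} (hu : ∀ i, ‖u i‖ = 1) :
    maxOffDiag (gramArray u) ∈ Set.Icc (-1 : ℝ) 1 := by
  obtain ⟨i, j, -, e⟩ := exists_eq_maxOffDiag hN (gramArray u)
  exact e ▸ ⟨neg_one_le_gramArray hu i j, gramArray_le_one hu i j⟩

theorem norm_sq_add_smul {x v : E3} (hx : ‖x‖ = 1) (h : inner ℝ x v = 0) (t : ℝ) :
    ‖x + t • v‖ ^ 2 = 1 + t ^ 2 * ‖v‖ ^ 2 := by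
  rw [norm_add_sq_real, inner_smul_right, h, norm_smul, hx, Real.norm_eq_abs, mul_pow, sq_abs]
  ring

theorem one_le_norm_add_smul {x v : E3} (hx : ‖x‖ = 1) (h : inner ℝ x v = 0) (t : ℝ) :
    1 ≤ ‖x + t • v‖ := by
  have := norm_sq_add_smul hx h t
  nlinarith [norm_nonneg (x + t • v), mul_nonneg (sq_nonneg t) (sq_nonneg ‖v‖)]

theorem norm_vary {N : ℕ} {u v : Fin N → E3} (hu : ∀ i, ‖u i‖ = 1) (hv : IsTangent u v) (t : ℝ)
    (i : Fin N) : ‖vary u v t i‖ = 1 := by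
  have := one_le_norm_add_smul (hu i) (hv i) t
  rw [vary, norm_smul, norm_inv, norm_norm, inv_mul_cancel₀ (by positivity)]

/-- First variation of the inner products, with an explicit quadratic error. -/
theorem abs_gramArray_vary_sub_le {N : ℕ} {u v : Fin N → E3} (hu : ∀ i, ‖u i‖ = 1)
    (hv : IsTangent u v) (t : ℝ) (i j : Fin N) :
    |gramArray (vary u v t) i j -
      (gramArray u i j + t * (inner ℝ (u i) (v j) + inner ℝ (v i) (u j)))| ≤
      t ^ 2 * (‖v i‖ ^ 2 + ‖v j‖ ^ 2) := by
  set a := ‖u i + t • v i‖ with ha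
  set b := ‖u j + t • v j‖ with hb
  have ha1 : 1 ≤ a := one_le_norm_add_smul (hu i) (hv i) t
  have hb1 : 1 ≤ b := one_le_norm_add_smul (hu j) (hv j) t
  have ha2 : a ^ 2 = 1 + t ^ 2 * ‖v i‖ ^ 2 := norm_sq_add_smul (hu i) (hv i) t
  have hb2 : b ^ 2 = 1 + t ^ 2 * ‖v j‖ ^ 2 := norm_sq_add_smul (hu j) (hv j) t
  set q := gramArray (vary u v t) i j with hq
  have hq1 : |q| ≤ 1 :=
    abs_le.2 ⟨neg_one_le_gramArray (norm_vary hu hv t) i j, gramArray_le_one (norm_vary hu hv t) i j⟩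
  have hnum : a * b * q = gramArray u i j + t * (inner ℝ (u i) (v j) + inner ℝ (v i) (u j))
      + t ^ 2 * inner ℝ (v i) (v j) := by
    have : q = a⁻¹ * (b⁻¹ * inner ℝ (u i + t • v i) (u j + t • v j)) := by
      simp only [hq, gramArray, vary, inner_smul_left, inner_smul_right]
      simp [ha, hb]
      ring
    rw [this]
    field_simp
    simp only [gramArray, inner_add_left, inner_add_right, inner_smul_left, inner_smul_right]
    simp
    ring
  have hE : |inner ℝ (v i) (v j)| ≤ (‖v i‖ ^ 2 + ‖v j‖ ^ 2) / 2 :=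
    (abs_real_inner_le_norm _ _).trans (by nlinarith [sq_nonneg (‖v i‖ - ‖v j‖)])
  have hab : a * b - 1 ≤ t ^ 2 * ((‖v i‖ ^ 2 + ‖v j‖ ^ 2) / 2) := by
    nlinarith [sq_nonneg (a - b)]
  have hab1 : 0 ≤ a * b - 1 := by nlinarith
  have e : q - (gramArray u i j + t * (inner ℝ (u i) (v j) + inner ℝ (v i) (u j))) =
      t ^ 2 * inner ℝ (v i) (v j) - (a * b - 1) * q := by linarith
  rw [e]
  calc _ ≤ |t ^ 2 * inner ℝ (v i) (v j)| + |(a * b - 1) * q| := abs_sub _ _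
    _ ≤ t ^ 2 * ((‖v i‖ ^ 2 + ‖v j‖ ^ 2) / 2) + (a * b - 1) * 1 := by
      rw [abs_mul, abs_mul, abs_of_nonneg (sq_nonneg t), abs_of_nonneg hab1]
      gcongr
    _ ≤ _ := by linarith

theorem add_arccos_le {x y : ℝ} (hy : 0 ≤ y) (hx : x ≤ 1) (hxy : -1 ≤ x - y) :
    Real.arccos x + y ≤ Real.arccos (x - y) := by
  have h1 := Real.cos_arccos (by linarith : -1 ≤ x) hx
  have h2 := Real.cos_arccos hxy (by linarith)
  have h3 : Real.arccos x ≤ Real.arccos (x - y) := Real.arccos_le_arccos (by linarith)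
  have h4 := Real.abs_cos_sub_cos_le (Real.arccos x) (Real.arccos (x - y))
  rw [h1, h2, abs_sub_comm (Real.arccos x), abs_of_nonneg (sub_nonneg.2 h3)] at h4
  have := le_abs_self (x - (x - y))
  linarith

/-- `w` is an equilibrium stress on the contact graph of `u`: nonnegative weights, supported on the
pairs with inner product `c`, such that the tensions in the directions of the neighbours of each
vertex cancel. -/
structure IsStress {N : ℕ} (u : Fin N → E3) (c : ℝ) (w : Fin N → Fin N → ℝ) : Prop where
  nonneg : ∀ i j, 0 ≤ w i j
  symm : ∀ i j, w i j = w j i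
  contact : ∀ i j, w i j ≠ 0 → i ≠ j ∧ inner ℝ (u i) (u j) = c
  balanced : ∀ i, ∑ j, w i j • (u j - c • u i) = 0

/-- Gordan's alternative for finitely many vectors. -/
theorem gordan {ι E : Type*} [Fintype ι] [NormedAddCommGroup E] [NormedSpace ℝ E] (g : ι → E) :
    (∃ f : StrongDual ℝ E, ∀ i, 0 < f (g i)) ∨
      ∃ w : ι → ℝ, (∀ i, 0 ≤ w i) ∧ (∃ i, w i ≠ 0) ∧ ∑ i, w i • g i = 0 := by
  classical
  let L : (ι → ℝ) →ₗ[ℝ] E := Fintype.linearCombination ℝ g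
  have hL : ∀ w, L w = ∑ i, w i • g i := fun w => Fintype.linearCombination_apply ..
  have hcont : Continuous L := by
    simp only [funext hL]
    fun_prop
  have hK : IsCompact (L '' stdSimplex ℝ ι) := (isCompact_stdSimplex ℝ ι).image hcont
  by_cases h0 : (0 : E) ∈ L '' stdSimplex ℝ ι
  · obtain ⟨w, ⟨hw0, hw1⟩, hw⟩ := h0
    refine Or.inr ⟨w, hw0, ?_, by rw [← hL, hw]⟩
    by_contra! h
    simp [h] at hw1
  · obtain ⟨f, s, hf0, hfs⟩ := geometric_hahn_banach_point_closed
      ((convex_stdSimplex ℝ ι).linear_image L) hK.isClosed h0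
    refine Or.inl ⟨f, fun i => ?_⟩
    have := hfs (g i) ⟨Pi.single i 1, single_mem_stdSimplex ℝ i, by simp [hL, Pi.single_apply]⟩
    rw [map_zero] at hf0
    linarith

/-- If the contact graph of `u` carries no stress, some tangent vector increases all the smallest
angles to first order. -/
theorem exists_expanding_of_no_stress {N : ℕ} {u : Fin N → E3} (hu : ∀ i, ‖u i‖ = 1) {c : ℝ}
    (h : ∀ w, IsStress u c w → w = 0) :
    ∃ v, IsTangent u v ∧ ∀ i j, i ≠ j → inner ℝ (u i) (u j) = c →
      inner ℝ (u i) (v j) + inner ℝ (v i) (u j) < 0 := by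
  classical
  -- `g p` is the gradient, on the product of spheres, of the inner product of the pair `p`
  let ι := {p : Fin N × Fin N // p.1 ≠ p.2 ∧ inner ℝ (u p.1) (u p.2) = c}
  let g : ι → (Fin N → E3) := fun p => Pi.single p.1.1 (u p.1.2 - c • u p.1.1) +
    Pi.single p.1.2 (u p.1.1 - c • u p.1.2)
  rcases gordan g with ⟨f, hf⟩ | ⟨W, hW0, ⟨p, hp⟩, hW⟩
  · let F : Fin N → E3 := fun i => (InnerProductSpace.toDual ℝ E3).symm
      (f.comp (ContinuousLinearMap.single ℝ (fun _ : Fin N => E3) i))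
    have hF : ∀ i x, inner ℝ (F i) x = f (Pi.single i x) := fun i x => by
      simp [F]
    have huu : ∀ i, inner ℝ (u i) (u i) = (1 : ℝ) := fun i => by
      rw [real_inner_self_eq_norm_sq, hu, one_pow]
    refine ⟨fun i => -(F i - (inner ℝ (F i) (u i) : ℝ) • u i), fun i => ?_, fun i j hij hc => ?_⟩
    · simp only [inner_neg_right, inner_sub_right, inner_smul_right, huu, real_inner_comm (F i)]
      simp
    · have h1 := hf ⟨(i, j), hij, hc⟩
      simp only [g, map_add, ← hF, inner_sub_right, inner_smul_right] at h1
      simp only [inner_neg_right, inner_neg_left, inner_sub_right, inner_sub_left,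
        inner_smul_right, inner_smul_left, hc, real_inner_comm (u i)]
      simp only [conj_trivial]
      rw [real_inner_comm (F j) (u i), real_inner_comm (F i) (u i)]
      linarith
  · exfalso
    let V : Fin N → Fin N → ℝ := fun i j =>
      if hij : i ≠ j ∧ inner ℝ (u i) (u j) = c then W ⟨(i, j), hij⟩ else 0
    have hV0 : ∀ i j, 0 ≤ V i j := fun i j => by
      simp only [V]; split_ifs; exacts [hW0 _, le_rfl]
    have hVc : ∀ i j, V i j ≠ 0 → i ≠ j ∧ inner ℝ (u i) (u j) = c := fun i j hne => by
      by_contra hcon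
      exact hne (dif_neg hcon)
    have hsum : ∀ k, ∑ i, ∑ j, V i j • ((Pi.single i (u j - c • u i) : Fin N → E3) k +
        (Pi.single j (u i - c • u j) : Fin N → E3) k) = 0 := fun k => by
      rw [← Fintype.sum_prod_type']
      rw [← Finset.sum_subset (Finset.subset_univ (Finset.univ.filter
        fun p : Fin N × Fin N => p.1 ≠ p.2 ∧ inner ℝ (u p.1) (u p.2) = c))]
      · rw [Finset.sum_subtype (p := fun p : Fin N × Fin N => p.1 ≠ p.2 ∧
          inner ℝ (u p.1) (u p.2) = c) _ (by simp)]
        have := congrFun hW k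
        simp only [Finset.sum_apply, Pi.smul_apply, Pi.zero_apply] at this
        rw [← this]
        refine Finset.sum_congr rfl fun p _ => ?_
        simp only [V, dif_pos p.2, g, Pi.add_apply]
      · intro p _ hp
        have : ¬ (p.1 ≠ p.2 ∧ inner ℝ (u p.1) (u p.2) = c) := by simpa using hp
        simp only [V, dif_neg this, zero_smul]
    have hst : IsStress u c (fun i j => V i j + V j i) := by
      refine ⟨fun i j => add_nonneg (hV0 _ _) (hV0 _ _), fun i j => add_comm _ _, fun i j hne => ?_,
        fun k => ?_⟩
      · by_cases h1 : V i j = 0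
        · have h2 : V j i ≠ 0 := fun h2 => hne (by rw [h1, h2, add_zero])
          obtain ⟨h3, h4⟩ := hVc j i h2
          exact ⟨h3.symm, by rw [real_inner_comm, h4]⟩
        · exact hVc i j h1
      · have := hsum k
        simp only [smul_add, Finset.sum_add_distrib, Pi.single_apply] at this
        rw [Finset.sum_comm (f := fun i j => V i j • if k = j then u i - c • u j else 0)] at this
        simpa [add_smul, Finset.sum_add_distrib, Finset.sum_ite_eq] using this
    have := congrFun (congrFun (h _ hst) p.1.1) p.1.2
    have hpos : 0 < V p.1.1 p.1.2 := by
      simp only [V, dif_pos p.2]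
      exact lt_of_le_of_ne (hW0 _) (Ne.symm hp)
    have h2 := hV0 p.1.2 p.1.1
    simp only [Pi.zero_apply] at this
    linarith

/-! ### Stresses on a minimal set of vertices -/

/-- The vertices that carry some tension. -/
noncomputable def stressed {N : ℕ} (w : Fin N → Fin N → ℝ) : Finset (Fin N) :=
  open Classical in Finset.univ.filter fun i => ∃ j, w i j ≠ 0

theorem mem_stressed {N : ℕ} {w : Fin N → Fin N → ℝ} {i : Fin N} :
    i ∈ stressed w ↔ ∃ j, w i j ≠ 0 := by simp [stressed]

theorem IsStress.self_eq_zero {N : ℕ} {u : Fin N → E3} {c : ℝ} {w : Fin N → Fin N → ℝ}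
    (hw : IsStress u c w) (i : Fin N) : w i i = 0 := by
  by_contra h
  exact (hw.contact i i h).1 rfl

/-- At a vertex `v` that separates `A` from the rest, the tensions coming from `A` are balanced by
themselves, since the total torque of the tensions on `A` vanishes. Here the torque about all axes
is encoded by the alternating forms `⟪u v, a⟫ ⟪y, b⟫ - ⟪y, a⟫ ⟪u v, b⟫`. -/
theorem IsStress.balanced_of_separates {N : ℕ} {u : Fin N → E3} (hu : ∀ i, ‖u i‖ = 1) {c : ℝ}
    {w : Fin N → Fin N → ℝ} (hw : IsStress u c w) {A : Finset (Fin N)} {v : Fin N} (hv : v ∉ A)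
    (hA : ∀ i ∈ A, ∀ j, w i j ≠ 0 → j ∈ A ∨ j = v) :
    ∑ i ∈ A, w v i • (u i - c • u v) = 0 := by
  refine ext_inner_left ℝ fun y => ?_
  let a : Fin N → Fin N → ℝ := fun i j => w i j *
    (inner ℝ (u v) (u i) * inner ℝ y (u j) - inner ℝ y (u i) * inner ℝ (u v) (u j))
  have ha : ∀ i, ∑ j, a i j = 0 := fun i => by
    have h1 := congrArg (fun x => inner ℝ (u v) (u i) * (inner ℝ y x : ℝ) -
      inner ℝ y (u i) * (inner ℝ (u v) x : ℝ)) (hw.balanced i)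
    simp only [inner_sum, inner_smul_right, inner_sub_right, inner_zero_right, mul_zero, sub_zero,
      Finset.mul_sum, ← Finset.sum_sub_distrib] at h1
    rw [← h1]
    exact Finset.sum_congr rfl fun j _ => by simp only [a]; ring
  have hanti : ∀ i j, a i j = -a j i := fun i j => by
    simp only [a, hw.symm i j]; ring
  have h0 : ∑ i ∈ A, ∑ j ∈ A, a i j = 0 := by
    have h1 : ∑ i ∈ A, ∑ j ∈ A, a i j = -∑ i ∈ A, ∑ j ∈ A, a i j := by
      conv_lhs => rw [Finset.sum_comm]
      simp only [← Finset.sum_neg_distrib]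
      exact Finset.sum_congr rfl fun i _ => Finset.sum_congr rfl fun j _ => hanti j i
    linarith
  have h1 : ∀ i ∈ A, ∑ j ∈ A, a i j + a i v = 0 := fun i hi => by
    rw [← ha i, ← Finset.sum_subset (Finset.subset_univ (insert v A)), Finset.sum_insert hv,
      add_comm]
    intro j _ hj
    have : w i j = 0 := by
      by_contra h
      rcases hA i hi j h with h | h
      · exact hj (Finset.mem_insert_of_mem h)
      · exact hj (h ▸ Finset.mem_insert_self _ _)
    simp [a, this]
  have h2 := Finset.sum_congr rfl h1
  rw [Finset.sum_add_distrib, h0, Finset.sum_const_zero, zero_add] at h2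
  rw [inner_sum, inner_zero_right, ← neg_eq_zero, ← h2, ← Finset.sum_neg_distrib]
  refine Finset.sum_congr rfl fun i _ => ?_
  simp only [a, inner_smul_right, inner_sub_right, real_inner_self_eq_norm_sq, hu, hw.symm i v]
  by_cases h : w v i = 0
  · simp [h]
  · rw [(hw.contact v i h).2]; ring

/-- The part of a stress on one side of a separating vertex is again a stress. -/
theorem IsStress.restrict {N : ℕ} {u : Fin N → E3} (hu : ∀ i, ‖u i‖ = 1) {c : ℝ}
    {w : Fin N → Fin N → ℝ} (hw : IsStress u c w) {A : Finset (Fin N)} {v : Fin N} (hv : v ∉ A)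
    (hA : ∀ i ∈ A, ∀ j, w i j ≠ 0 → j ∈ A ∨ j = v) :
    IsStress u c fun i j => if i ∈ insert v A ∧ j ∈ insert v A then w i j else 0 := by
  refine ⟨fun i j => ?_, fun i j => ?_, fun i j h => ?_, fun i => ?_⟩
  · split_ifs; exacts [hw.nonneg i j, le_rfl]
  · simp only [and_comm, hw.symm i j]
  · exact hw.contact i j fun h0 => h (by simp [h0])
  · by_cases hi : i ∈ insert v A
    · simp only [hi, true_and, ite_smul, zero_smul, Finset.sum_ite_mem, Finset.univ_inter]
      rcases Finset.mem_insert.1 hi with rfl | hiA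
      · rw [Finset.sum_insert hv, hw.self_eq_zero, zero_smul, zero_add]
        exact hw.balanced_of_separates hu hv hA
      · rw [← hw.balanced i]
        refine Finset.sum_subset (Finset.subset_univ _) fun j _ hj => ?_
        have : w i j = 0 := by
          by_contra h
          exact hj (Finset.mem_insert.2 ((hA i hiA j h).symm))
        rw [this, zero_smul]
    · simp [hi]

/-- A nonzero stress on an inclusion-minimal set of vertices. -/
structure IsMinimalStress {N : ℕ} (u : Fin N → E3) (c : ℝ) (w : Fin N → Fin N → ℝ) : Prop
    extends IsStress u c w where
  ne_zero : w ≠ 0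
  minimal : ∀ w', IsStress u c w' → w' ≠ 0 → stressed w' ⊆ stressed w → stressed w ⊆ stressed w'

theorem IsStress.exists_minimal {N : ℕ} {u : Fin N → E3} {c : ℝ} {w : Fin N → Fin N → ℝ}
    (hw : IsStress u c w) (h0 : w ≠ 0) : ∃ w', IsMinimalStress u c w' := by
  induction hn : (stressed w).card using Nat.strong_induction_on generalizing w with
  | _ n ih =>
    by_cases h : ∀ w', IsStress u c w' → w' ≠ 0 → stressed w' ⊆ stressed w →
        stressed w ⊆ stressed w'
    · exact ⟨w, hw, h0, h⟩
    · push Not at h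
      obtain ⟨w', hw', h0', hsub, hns⟩ := h
      exact ih _ (hn ▸ Finset.card_lt_card ⟨hsub, hns⟩) hw' h0' rfl

theorem IsMinimalStress.stressed_subset {N : ℕ} {u : Fin N → E3} (hu : ∀ i, ‖u i‖ = 1) {c : ℝ}
    {w : Fin N → Fin N → ℝ} (hw : IsMinimalStress u c w) {A : Finset (Fin N)} {v : Fin N}
    (hv : v ∉ A) (hA : ∀ i ∈ A, ∀ j, w i j ≠ 0 → j ∈ A ∨ j = v) (hne : ∃ i ∈ A, i ∈ stressed w) :
    stressed w ⊆ insert v A := by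
  obtain ⟨i, hiA, hi⟩ := hne
  obtain ⟨j, hj⟩ := mem_stressed.1 hi
  refine (hw.minimal _ (hw.restrict hu hv hA) ?_ ?_).trans ?_
  · intro h
    have := congrFun (congrFun h i) j
    simp only [Finset.mem_insert_of_mem hiA, true_and, Pi.zero_apply, ite_eq_right_iff] at this
    exact hj (this (Finset.mem_insert.2 ((hA i hiA j hj).symm)))
  · intro k hk
    obtain ⟨l, hl⟩ := mem_stressed.1 hk
    exact mem_stressed.2 ⟨l, fun h => hl (by simp [h])⟩
  · intro k hk
    obtain ⟨l, hl⟩ := mem_stressed.1 hk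
    by_contra h
    exact hl (by simp [h])

/-- The graph of a minimal stress has no cut vertex. -/
theorem IsMinimalStress.reachable_avoiding {N : ℕ} {u : Fin N → E3} (hu : ∀ i, ‖u i‖ = 1) {c : ℝ}
    {w : Fin N → Fin N → ℝ} (hw : IsMinimalStress u c w) {v x y : Fin N} (hx : x ∈ stressed w)
    (hxv : x ≠ v) (hy : y ∈ stressed w) (hyv : y ≠ v) :
    Relation.ReflTransGen (fun a b => w a b ≠ 0 ∧ b ≠ v) x y := by
  classical
  let A : Finset (Fin N) := Finset.univ.filter fun z => z ≠ v ∧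
    Relation.ReflTransGen (fun a b => w a b ≠ 0 ∧ b ≠ v) x z
  have hsub : stressed w ⊆ insert v A := by
    refine hw.stressed_subset hu (by simp [A]) (fun i hi j hij => ?_)
      ⟨x, by simp [A, hxv, Relation.ReflTransGen.refl], hx⟩
    simp only [A, Finset.mem_filter, Finset.mem_univ, true_and] at hi ⊢
    by_cases hjv : j = v
    · exact Or.inr hjv
    · exact Or.inl ⟨hjv, hi.2.tail ⟨hij, hjv⟩⟩
  rcases Finset.mem_insert.1 (hsub hy) with h | h
  · exact absurd h hyv
  · simp only [A, Finset.mem_filter, Finset.mem_univ, true_and] at h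
    exact h.2

theorem IsMinimalStress.reachable {N : ℕ} {u : Fin N → E3} (hu : ∀ i, ‖u i‖ = 1) {c : ℝ}
    {w : Fin N → Fin N → ℝ} (hw : IsMinimalStress u c w) {x y : Fin N} (hx : x ∈ stressed w)
    (hy : y ∈ stressed w) : Relation.ReflTransGen (fun a b => w a b ≠ 0) x y := by
  by_cases hxy : y = x
  · rw [hxy]
  obtain ⟨z, hz⟩ := mem_stressed.1 hx
  have hzx : z ≠ x := (hw.contact x z hz).1.symm
  have hzs : z ∈ stressed w := mem_stressed.2 ⟨x, by rwa [hw.symm]⟩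
  exact .head hz ((Relation.ReflTransGen.mono (fun a b h => h.1)) _ _
    (hw.reachable_avoiding hu hzs hzx hy hxy))

/-! ### Simple paths through a given edge of a graph without cut vertices -/

section paths

variable {V : Type*} {r : V → V → Prop}

/-- A walk from `z` to a point of `P` avoiding `y` yields a simple path from `z` to `P` which meets
`P` only in its end `c`. -/
theorem exists_path_to_list {P : List V} {y z t : V} (hzy : z ≠ y) (ht : t ∈ P)
    (h : Relation.ReflTransGen (fun a b => r a b ∧ b ≠ y) z t) :
    ∃ (Q : List V) (c : V), c ∈ P ∧ c ≠ y ∧ (Q ++ [c]).IsChain r ∧ Q.Nodup ∧ List.Disjoint Q P ∧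
      (Q ++ [c]).head? = some z := by
  induction h using Relation.ReflTransGen.head_induction_on with
  | refl => exact ⟨[], t, ht, hzy, by simp, by simp, by simp, by simp⟩
  | @head z z' hzz' _ ih =>
    by_cases hzP : z ∈ P
    · exact ⟨[], z, hzP, hzy, by simp, by simp, by simp, by simp⟩
    obtain ⟨Q, c, hcP, hcy, hch, hnd, hdis, hhd⟩ := ih hzz'.2
    by_cases hzQ : z ∈ Q
    · obtain ⟨Q₁, Q₂, rfl⟩ := List.append_of_mem hzQ
      refine ⟨z :: Q₂, c, hcP, hcy, ?_, ?_, ?_, by simp⟩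
      · rw [List.append_assoc] at hch
        exact hch.right_of_append
      · exact hnd.of_append_right
      · exact fun x hx => hdis (List.mem_append_right _ hx)
    · refine ⟨z :: Q, c, hcP, hcy, ?_, List.nodup_cons.2 ⟨hzQ, hnd⟩, ?_, by simp⟩
      · rw [List.cons_append, List.isChain_cons]
        exact ⟨fun x hx => by rw [hhd] at hx; simp at hx; exact hx ▸ hzz'.1, hch⟩
      · exact List.disjoint_cons_left.2 ⟨hzP, hdis⟩

/-- Rerouting a simple path through an edge `y z` that starts on it: the rerouted path rejoins the
old one after `y`. -/
theorem exists_reroute_right {A B Q : List V} {y z c : V} (hch : (A ++ y :: B).IsChain r)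
    (hnd : (A ++ y :: B).Nodup) (hyz : r y z) (hc : c ∈ B) (hQ : (Q ++ [c]).IsChain r)
    (hQnd : Q.Nodup) (hdis : List.Disjoint Q (A ++ y :: B)) (hz : (Q ++ [c]).head? = some z) :
    ∃ B', (A ++ y :: z :: B').IsChain r ∧ (A ++ y :: z :: B').Nodup ∧
      (A ++ y :: z :: B').getLast? = (A ++ y :: B).getLast? := by
  obtain ⟨B₁, B₂, rfl⟩ := List.append_of_mem hc
  obtain ⟨B', hB'⟩ : ∃ B', Q ++ c :: B₂ = z :: B' := by
    cases Q with
    | nil => simp at hz; exact ⟨B₂, by simp [hz]⟩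
    | cons q Q => simp at hz; exact ⟨Q ++ c :: B₂, by simp [hz]⟩
  refine ⟨B', ?_⟩
  rw [← hB']
  have hsub : List.Sublist (A ++ y :: c :: B₂) (A ++ y :: (B₁ ++ c :: B₂)) :=
    (List.Sublist.refl A).append ((List.sublist_append_right _ _).cons_cons y)
  refine ⟨?_, ?_, ?_⟩
  · rw [List.isChain_split] at hch ⊢
    refine ⟨hch.1, ?_⟩
    rw [List.isChain_cons]
    refine ⟨fun x hx => ?_, ?_⟩
    · rw [hB'] at hx; simp at hx; exact hx ▸ hyz
    · rw [List.isChain_split]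
      refine ⟨hQ, ?_⟩
      have h2 := hch.2
      rw [← List.cons_append] at h2
      exact h2.right_of_append
  · have h1 : (Q ++ (A ++ y :: c :: B₂)).Nodup :=
      List.Nodup.append hQnd (hnd.sublist hsub)
        fun x hx hx' => hdis hx (hsub.subset hx')
    refine (List.Perm.nodup_iff ?_).1 h1
    calc (Q ++ (A ++ y :: c :: B₂)).Perm (Q ++ ((A ++ [y]) ++ c :: B₂)) := by simp
      _ |>.Perm ((A ++ [y]) ++ (Q ++ c :: B₂)) :=
        List.perm_append_comm_assoc _ _ _
      _ |>.Perm _ := by simp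
  · simp [List.getLast?_append, List.getLast?_cons]

/-- In a graph without cut vertices, a simple path from `a` to `b` through `y` can be rerouted
through any given edge at `y`. -/
theorem exists_reroute {P : List V} {y z t a b : V} (hr : ∀ x x', r x x' → r x' x)
    (hch : P.IsChain r) (hnd : P.Nodup) (ha : P.head? = some a) (hb : P.getLast? = some b)
    (hy : y ∈ P) (hyz : r y z) (hzy : z ≠ y) (ht : t ∈ P)
    (h : Relation.ReflTransGen (fun a b => r a b ∧ b ≠ y) z t) :
    ∃ P' : List V, P'.IsChain r ∧ P'.Nodup ∧ P'.head? = some a ∧ P'.getLast? = some b ∧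
      ∃ A B, P' = A ++ y :: z :: B ∨ P' = A ++ z :: y :: B := by
  obtain ⟨A, B, rfl⟩ := List.append_of_mem hy
  obtain ⟨Q, c, hcP, hcy, hQ, hQnd, hdis, hz⟩ := exists_path_to_list hzy ht h
  have hcAB : c ∈ B ∨ c ∈ A := by
    simp only [List.mem_append, List.mem_cons] at hcP
    tauto
  rcases hcAB with hc | hc
  · obtain ⟨B', h1, h2, h3⟩ := exists_reroute_right hch hnd hyz hc hQ hQnd hdis hz
    refine ⟨_, h1, h2, ?_, h3.trans hb, A, B', Or.inl rfl⟩
    rw [← ha]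
    simp [List.head?_append]
  · have hrev : (A ++ y :: B).reverse = B.reverse ++ y :: A.reverse := by simp
    obtain ⟨B', h1, h2, h3⟩ := exists_reroute_right (A := B.reverse) (B := A.reverse) (Q := Q)
      (y := y) (z := z) (c := c) (r := r)
      (by rw [← hrev, List.isChain_reverse]; exact hch.imp fun _ _ => hr _ _)
      (by rw [← hrev]; exact List.nodup_reverse.2 hnd) hyz (by simpa using hc) hQ hQnd
      (by rw [← hrev]; exact fun x hx hx' => hdis hx (List.mem_reverse.1 hx')) hz
    refine ⟨(B.reverse ++ y :: z :: B').reverse, ?_, List.nodup_reverse.2 h2, ?_, ?_,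
      B'.reverse, B, Or.inr (by simp)⟩
    · rw [List.isChain_reverse]; exact h1.imp fun _ _ => hr _ _
    · rw [List.head?_reverse, h3, ← hrev, List.getLast?_reverse, ha]
    · rw [List.getLast?_reverse, ← hb]
      have : (B.reverse ++ y :: z :: B').head? = (B.reverse ++ y :: A.reverse).head? := by
        simp [List.head?_append]
      rw [this, ← hrev, List.head?_reverse]

end paths

/-- In the graph of a minimal stress, every edge lies on a simple path joining the ends of a given
edge `a b`; so any two edges lie on a common simple cycle. -/
theorem IsMinimalStress.exists_path {N : ℕ} {u : Fin N → E3} (hu : ∀ i, ‖u i‖ = 1) {c : ℝ}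
    {w : Fin N → Fin N → ℝ} (hw : IsMinimalStress u c w) {a b y z : Fin N} (hab : w a b ≠ 0)
    (hyz : w y z ≠ 0) :
    ∃ P : List (Fin N), P.IsChain (fun i j => w i j ≠ 0) ∧ P.Nodup ∧ P.head? = some a ∧
      P.getLast? = some b ∧ ∃ A B, P = A ++ y :: z :: B ∨ P = A ++ z :: y :: B := by
  have hne : a ≠ b := (hw.contact a b hab).1
  have hr : ∀ i j, w i j ≠ 0 → w j i ≠ 0 := fun i j h => by rwa [hw.symm]
  have has : a ∈ stressed w := mem_stressed.2 ⟨b, hab⟩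
  have hbs : b ∈ stressed w := mem_stressed.2 ⟨a, hr _ _ hab⟩
  have key : ∀ P : List (Fin N), P.IsChain (fun i j => w i j ≠ 0) → P.Nodup → P.head? = some a →
      P.getLast? = some b → ∀ y z, y ∈ P → w y z ≠ 0 → ∃ P' : List (Fin N),
        P'.IsChain (fun i j => w i j ≠ 0) ∧ P'.Nodup ∧ P'.head? = some a ∧
        P'.getLast? = some b ∧ ∃ A B, P' = A ++ y :: z :: B ∨ P' = A ++ z :: y :: B := by
    intro P h1 h2 h3 h4 y z hy hyz
    have hzy : z ≠ y := (hw.contact y z hyz).1.symm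
    have hzs : z ∈ stressed w := mem_stressed.2 ⟨y, hr _ _ hyz⟩
    obtain ⟨t, ht, hty, hts⟩ : ∃ t ∈ P, t ≠ y ∧ t ∈ stressed w := by
      by_cases h : a = y
      · exact ⟨b, List.mem_of_getLast? h4, fun h' => hne (h.trans h'.symm), hbs⟩
      · exact ⟨a, List.mem_of_head? h3, h, has⟩
    exact exists_reroute hr h1 h2 h3 h4 hy hyz hzy ht (hw.reachable_avoiding hu hzs hzy hts hty)
  have hall : ∀ y, Relation.ReflTransGen (fun i j => w i j ≠ 0) a y → ∃ P : List (Fin N),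
      P.IsChain (fun i j => w i j ≠ 0) ∧ P.Nodup ∧ P.head? = some a ∧ P.getLast? = some b ∧
        y ∈ P := by
    intro y hy
    induction hy with
    | refl => exact ⟨[a, b], by simp [hab], by simp [hne], by simp, by simp, by simp⟩
    | tail _ h ih =>
      obtain ⟨P, h1, h2, h3, h4, hyP⟩ := ih
      obtain ⟨P', h1, h2, h3, h4, A, B, h5⟩ := key P h1 h2 h3 h4 _ _ hyP h
      exact ⟨P', h1, h2, h3, h4, by rcases h5 with rfl | rfl <;> simp⟩
  obtain ⟨P, h1, h2, h3, h4, hyP⟩ := hall y (hw.reachable hu has (mem_stressed.2 ⟨z, hyz⟩))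
  exact key P h1 h2 h3 h4 y z hyP hyz

/-! ### The stressed graph on the sphere meets its antipodal image -/

/-- The unit tangent vector at `x` pointing towards `y`, for unit vectors at angle `ℓ`. -/
noncomputable def edgeDir (ℓ : ℝ) (x y : E3) : E3 := (Real.sin ℓ)⁻¹ • (y - Real.cos ℓ • x)

/-- The unit speed parametrization of the arc of great circle from `x` to `y`, for unit vectors at
angle `ℓ`. -/
noncomputable def arcPoint (ℓ : ℝ) (x y : E3) (s : ℝ) : E3 :=
  Real.cos s • x + Real.sin s • edgeDir ℓ x y

/-- The velocity of `arcPoint`. -/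
noncomputable def arcVel (ℓ : ℝ) (x y : E3) (s : ℝ) : E3 :=
  -Real.sin s • x + Real.cos s • edgeDir ℓ x y

section arc

variable {ℓ : ℝ} {x y : E3}

theorem arcPoint_zero : arcPoint ℓ x y 0 = x := by simp [arcPoint]

theorem arcPoint_end (hℓ : Real.sin ℓ ≠ 0) : arcPoint ℓ x y ℓ = y := by
  simp [arcPoint, edgeDir, smul_smul, mul_inv_cancel₀ hℓ]

theorem arcPoint_add (s r : ℝ) :
    arcPoint ℓ x y (s + r) = Real.cos r • arcPoint ℓ x y s + Real.sin r • arcVel ℓ x y s := by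
  simp only [arcPoint, arcVel, Real.cos_add, Real.sin_add]
  module

theorem arcPoint_swap (hℓ : Real.sin ℓ ≠ 0) (s : ℝ) :
    arcPoint ℓ y x (ℓ - s) = arcPoint ℓ x y s := by
  simp only [arcPoint, edgeDir, Real.cos_sub, Real.sin_sub, smul_sub, smul_smul]
  have h1 : Real.cos ℓ ^ 2 = 1 - Real.sin ℓ ^ 2 := by
    rw [← Real.sin_sq_add_cos_sq ℓ]; ring
  match_scalars
  · field_simp
    linear_combination Real.sin s * h1
  · field_simp
    ring

theorem inner_edgeDir (hx : ‖x‖ = 1) (hxy : inner ℝ x y = Real.cos ℓ) :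
    inner ℝ x (edgeDir ℓ x y) = 0 := by
  simp [edgeDir, inner_smul_right, inner_sub_right, hx, hxy]

theorem norm_edgeDir (hℓ : Real.sin ℓ ≠ 0) (hx : ‖x‖ = 1) (hy : ‖y‖ = 1)
    (hxy : inner ℝ x y = Real.cos ℓ) : ‖edgeDir ℓ x y‖ = 1 := by
  have h : ‖edgeDir ℓ x y‖ ^ 2 = 1 := by
    rw [edgeDir, norm_smul, mul_pow, norm_sub_sq_real, inner_smul_right, real_inner_comm, hxy,
      norm_smul, hx, hy, norm_inv, inv_pow, Real.norm_eq_abs, Real.norm_eq_abs, mul_one, sq_abs,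
      sq_abs]
    field_simp
    nlinarith [Real.sin_sq_add_cos_sq ℓ]
  exact (pow_eq_one_iff_of_nonneg (norm_nonneg _) two_ne_zero).1 h

theorem norm_cos_smul_add_sin_smul {p q : E3} (hp : ‖p‖ = 1) (hq : ‖q‖ = 1)
    (h : inner ℝ p q = 0) (s : ℝ) : ‖Real.cos s • p + Real.sin s • q‖ = 1 := by
  have h : ‖Real.cos s • p + Real.sin s • q‖ ^ 2 = 1 := by
    rw [norm_add_sq_real, inner_smul_left, inner_smul_right, h, norm_smul, norm_smul, hp, hq]
    simp
  exact (pow_eq_one_iff_of_nonneg (norm_nonneg _) two_ne_zero).1 h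

theorem norm_arcPoint (hℓ : Real.sin ℓ ≠ 0) (hx : ‖x‖ = 1) (hy : ‖y‖ = 1)
    (hxy : inner ℝ x y = Real.cos ℓ) (s : ℝ) : ‖arcPoint ℓ x y s‖ = 1 :=
  norm_cos_smul_add_sin_smul hx (norm_edgeDir hℓ hx hy hxy) (inner_edgeDir hx hxy) s

theorem arcVel_eq (s : ℝ) : arcVel ℓ x y s = arcPoint ℓ x y (s + Real.pi / 2) := by
  simp [arcVel, arcPoint, Real.cos_add_pi_div_two, Real.sin_add_pi_div_two]

theorem inner_arcPoint_arcVel (hℓ : Real.sin ℓ ≠ 0) (hx : ‖x‖ = 1) (hy : ‖y‖ = 1)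
    (hxy : inner ℝ x y = Real.cos ℓ) (s : ℝ) :
    inner ℝ (arcPoint ℓ x y s) (arcVel ℓ x y s) = 0 := by
  have h1 := inner_edgeDir hx hxy
  simp only [arcPoint, arcVel, inner_add_left, inner_add_right, inner_smul_left, inner_smul_right,
    real_inner_self_eq_norm_sq, hx, norm_edgeDir hℓ hx hy hxy, h1, real_inner_comm x]
  simp
  ring

theorem continuous_arcPoint : Continuous (arcPoint ℓ x y) := by
  unfold arcPoint; fun_prop

end arc

/-- The union of the stressed edges, as arcs of great circles of length `ℓ`. -/
def stressGraph {N : ℕ} (u : Fin N → E3) (ℓ : ℝ) (w : Fin N → Fin N → ℝ) : Set E3 :=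
  {x | ∃ i j s, w i j ≠ 0 ∧ s ∈ Set.Icc 0 ℓ ∧ arcPoint ℓ (u i) (u j) s = x}

theorem isCompact_stressGraph {N : ℕ} (u : Fin N → E3) (ℓ : ℝ) (w : Fin N → Fin N → ℝ) :
    IsCompact (stressGraph u ℓ w) := by
  have : stressGraph u ℓ w = ⋃ i, ⋃ j, ⋃ _ : w i j ≠ 0,
      arcPoint ℓ (u i) (u j) '' Set.Icc 0 ℓ := by
    ext x
    simp [stressGraph]
  rw [this]
  exact isCompact_iUnion fun i => isCompact_iUnion fun j => isCompact_iUnion fun _ =>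
    isCompact_Icc.image continuous_arcPoint

/-- `τ` is a unit direction in which the set `G` of unit vectors contains an arc of great circle
starting at `x`. -/
def IsDirection (G : Set E3) (x τ : E3) : Prop :=
  ‖τ‖ = 1 ∧ inner ℝ x τ = 0 ∧
    ∃ ε > 0, ∀ s ∈ Set.Icc 0 ε, Real.cos s • x + Real.sin s • τ ∈ G

/-- At `x`, the set `G` has finitely many directions with a vanishing positive combination. The
index type may be larger; the weights select the directions. -/
def HasBalancedDirections (G : Set E3) (x : E3) : Prop :=
  ∃ (ι : Type) (_ : Fintype ι) (ω : ι → ℝ) (τ : ι → E3), (∀ k, 0 ≤ ω k) ∧ (∃ k, 0 < ω k) ∧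
    ∑ k, ω k • τ k = 0 ∧ ∀ k, 0 < ω k → IsDirection G x (τ k)

theorem IsStress.hasBalancedDirections {N : ℕ} {u : Fin N → E3} (hu : ∀ i, ‖u i‖ = 1) {ℓ : ℝ}
    (hℓ0 : 0 < ℓ) (hℓ : ℓ < Real.pi) {w : Fin N → Fin N → ℝ} (hw : IsStress u (Real.cos ℓ) w)
    {x : E3} (hx : x ∈ stressGraph u ℓ w) : HasBalancedDirections (stressGraph u ℓ w) x := by
  have hs : Real.sin ℓ ≠ 0 := (Real.sin_pos_of_pos_of_lt_pi hℓ0 hℓ).ne'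
  have vertex : ∀ i j, w i j ≠ 0 → HasBalancedDirections (stressGraph u ℓ w) (u i) := by
    intro i j hij
    refine ⟨Fin N, inferInstance, w i, fun j => edgeDir ℓ (u i) (u j), hw.nonneg i,
      ⟨j, lt_of_le_of_ne (hw.nonneg i j) hij.symm⟩, ?_, fun k hk => ?_⟩
    · simp only [edgeDir, smul_comm (w i _) (Real.sin ℓ)⁻¹, ← Finset.smul_sum, hw.balanced,
        smul_zero]
    · have hc := (hw.contact i k hk.ne').2
      exact ⟨norm_edgeDir hs (hu i) (hu k) hc, inner_edgeDir (hu i) hc, ℓ, hℓ0, fun s hs' =>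
        ⟨i, k, s, hk.ne', hs', rfl⟩⟩
  obtain ⟨i, j, s, hij, hs', rfl⟩ := hx
  rcases hs'.1.eq_or_lt with rfl | h0
  · rw [arcPoint_zero]; exact vertex i j hij
  rcases hs'.2.eq_or_lt with rfl | h1
  · rw [arcPoint_end hs]; exact vertex j i (by rwa [hw.symm])
  have hc := (hw.contact i j hij).2
  have hvel : ‖arcVel ℓ (u i) (u j) s‖ = 1 := by
    rw [arcVel_eq]; exact norm_arcPoint hs (hu i) (hu j) hc _
  have hperp := inner_arcPoint_arcVel hs (hu i) (hu j) hc s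
  refine ⟨Bool, inferInstance, fun _ => 1, fun b => cond b (arcVel ℓ (u i) (u j) s)
    (-arcVel ℓ (u i) (u j) s), fun _ => zero_le_one, ⟨true, zero_lt_one⟩, by simp, fun b _ => ?_⟩
  cases b
  · refine ⟨by simpa using hvel, by simpa using hperp, s, h0, fun r hr =>
      ⟨i, j, s + -r, hij, ⟨by linarith [hr.2], by linarith [hr.1]⟩, ?_⟩⟩
    rw [arcPoint_add]; simp
  · exact ⟨hvel, hperp, ℓ - s, by linarith, fun r hr =>
      ⟨i, j, s + r, hij, ⟨by linarith [hr.1], by linarith [hr.2]⟩, arcPoint_add _ _⟩⟩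

theorem nonpos_of_cos_mul_add_sin_mul_le {m g ε : ℝ} (hε : 0 < ε)
    (h : ∀ s ∈ Set.Icc 0 ε, Real.cos s * m + Real.sin s * g ≤ m) : g ≤ 0 := by
  by_contra! hg
  let s := min (min ε 1) (g / (|m| + 1))
  have hm : 0 < |m| + 1 := by positivity
  have hs0 : 0 < s := lt_min (lt_min hε one_pos) (by positivity)
  have hs1 : s ≤ 1 := (min_le_left _ _).trans (min_le_right _ _)
  have hsg : s * (|m| + 1) ≤ g := (le_div_iff₀ hm).1 (min_le_right _ _)
  have h1 := h s ⟨hs0.le, (min_le_left _ _).trans (min_le_left _ _)⟩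
  have h2 := Real.one_sub_sq_div_two_le_cos (x := s)
  have h3 : s / 2 < Real.sin s := by
    have := Real.sin_gt_sub_cube hs0
    have h5 : s ^ 3 ≤ s := pow_le_of_le_one hs0.le hs1 (by norm_num)
    linarith
  have h4 : m * (1 - Real.cos s) ≤ |m| * (s ^ 2 / 2) :=
    mul_le_mul (le_abs_self m) (by linarith) (by linarith [Real.cos_le_one s]) (abs_nonneg m)
  nlinarith [mul_lt_mul_of_pos_right h3 hg]

/-- In three dimensions, two unit vectors orthogonal to the same plane agree up to sign. -/
theorem inner_sq_eq_one_of_orthogonal {x q τ σ : E3} (hx : ‖x‖ = 1) (hq : ‖q‖ = 1)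
    (hτ : ‖τ‖ = 1) (hσ : ‖σ‖ = 1) (hxq : (inner ℝ x q : ℝ) ^ 2 ≠ 1) (h1 : inner ℝ x τ = 0)
    (h2 : inner ℝ q τ = 0) (h3 : inner ℝ x σ = 0) (h4 : inner ℝ q σ = 0) :
    (inner ℝ τ σ : ℝ) ^ 2 = 1 := by
  have hdep : ¬ LinearIndependent ℝ ![x, q, τ, σ] := fun h => by
    have := h.fintype_card_le_finrank
    simp at this
  obtain ⟨g, hg, k, hk⟩ := Fintype.not_linearIndependent_iff.1 hdep
  simp only [Fin.sum_univ_four, Matrix.cons_val] at hg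
  have ex := congrArg (fun v => (inner ℝ x v : ℝ)) hg
  have eq := congrArg (fun v => (inner ℝ q v : ℝ)) hg
  have et := congrArg (fun v => (inner ℝ τ v : ℝ)) hg
  have es := congrArg (fun v => (inner ℝ σ v : ℝ)) hg
  simp only [inner_add_right, inner_smul_right, inner_zero_right, real_inner_self_eq_norm_sq, hx,
    hq, hτ, hσ, h1, h2, h3, h4, real_inner_comm x q, real_inner_comm x τ, real_inner_comm x σ,
    real_inner_comm q τ, real_inner_comm q σ, real_inner_comm τ σ] at ex eq et es
  have hg0 : g 0 * ((inner ℝ x q : ℝ) ^ 2 - 1) = 0 := by linear_combination (inner ℝ x q : ℝ) * eq - ex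
  have hg1 : g 1 * ((inner ℝ x q : ℝ) ^ 2 - 1) = 0 := by linear_combination (inner ℝ x q : ℝ) * ex - eq
  have hne := sub_ne_zero.2 hxq
  have hg0' := (mul_eq_zero.1 hg0).resolve_right hne
  have hg1' := (mul_eq_zero.1 hg1).resolve_right hne
  by_contra hcon
  have hne' := sub_ne_zero.2 hcon
  have hg2 : g 2 * ((inner ℝ τ σ : ℝ) ^ 2 - 1) = 0 := by linear_combination (inner ℝ τ σ : ℝ) * es - et
  have hg3 : g 3 * ((inner ℝ τ σ : ℝ) ^ 2 - 1) = 0 := by linear_combination (inner ℝ τ σ : ℝ) * et - es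
  have hg2' := (mul_eq_zero.1 hg2).resolve_right hne'
  have hg3' := (mul_eq_zero.1 hg3).resolve_right hne'
  fin_cases k
  exacts [hk hg0', hk hg1', hk hg2', hk hg3']

/-- A compact set of unit vectors with balanced directions meets its antipodal image. For a pair
`x, q` in the set with `-x` as close as possible to `q`, the directions at `x` and `q` would all be
orthogonal to `x` and `q` by the first variation; and the distance from `-x` to `q` shrinks when
both points move in parallel along their common normal, the sphere having positive curvature. -/
theorem exists_antipodal {G : Set E3} (hG : IsCompact G) (hunit : ∀ x ∈ G, ‖x‖ = 1)
    (hbal : ∀ x ∈ G, HasBalancedDirections G x) (hne : ∃ x ∈ G, ∃ q ∈ G, x ≠ q) :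
    ∃ x ∈ G, -x ∈ G := by
  obtain ⟨a, ha, b, hb, hab⟩ := hne
  obtain ⟨⟨x, q⟩, ⟨hx, hq⟩, hmax⟩ := (hG.prod hG).exists_isMaxOn ⟨(a, a), ha, ha⟩
    (f := fun p : E3 × E3 => -(inner ℝ p.1 p.2 : ℝ)) (by fun_prop)
  have hmax' : ∀ x' ∈ G, ∀ q' ∈ G, -(inner ℝ x' q' : ℝ) ≤ -inner ℝ x q :=
    fun x' hx' q' hq' => hmax (Set.mk_mem_prod hx' hq')
  have hx1 := hunit x hx
  have hq1 := hunit q hq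
  by_cases hm1 : (inner ℝ x q : ℝ) = -1
  · refine ⟨x, hx, ?_⟩
    have : inner ℝ x (-q) = ‖x‖ * ‖-q‖ := by simp [hm1, hx1, hq1]
    have h2 := (inner_eq_norm_mul_iff_real.1 this)
    simp only [norm_neg, hx1, hq1, one_smul] at h2
    rw [h2, neg_neg]
    exact hq
  exfalso
  have hgt : (-1 : ℝ) < inner ℝ x q := by
    refine lt_of_le_of_ne ?_ (Ne.symm hm1)
    have := (abs_le.1 (abs_real_inner_le_norm x q)).1
    simpa [hx1, hq1] using this
  have hlt : (inner ℝ x q : ℝ) < 1 := by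
    have h1 := hmax' a ha b hb
    have h2 := inner_lt_one_iff_real_of_norm_eq_one (hunit a ha) (hunit b hb) |>.2 hab
    linarith
  obtain ⟨ι, _, ω, τ, hω, ⟨k, hk⟩, hsum, hdir⟩ := hbal x hx
  obtain ⟨ι', _, ω', σ, hω', ⟨k', hk'⟩, hsum', hdir'⟩ := hbal q hq
  have hτq : ∀ k, 0 < ω k → (inner ℝ q (τ k) : ℝ) = 0 := by
    have hnn : ∀ k, 0 ≤ ω k * inner ℝ q (τ k) := fun k => by
      rcases (hω k).eq_or_lt with h0 | h0
      · rw [← h0, zero_mul]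
      obtain ⟨-, -, ε, hε, hs⟩ := hdir k h0
      have := nonpos_of_cos_mul_add_sin_mul_le (m := -inner ℝ x q) (g := -inner ℝ q (τ k)) hε
        fun s hs' => by
          have := hmax' _ (hs s hs') q hq
          simp only [inner_add_left, inner_smul_left, conj_trivial] at this
          rw [real_inner_comm (τ k) q]
          linarith
      exact mul_nonneg h0.le (by linarith)
    have h0 : ∑ k, ω k * (inner ℝ q (τ k) : ℝ) = 0 := by
      have := congrArg (fun v => (inner ℝ q v : ℝ)) hsum
      simpa [inner_sum, inner_smul_right] using this
    intro k hk
    exact (mul_eq_zero.1 ((Finset.sum_eq_zero_iff_of_nonneg fun k _ => hnn k).1 h0 k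
      (Finset.mem_univ k))).resolve_left hk.ne'
  have hσx : ∀ k, 0 < ω' k → (inner ℝ x (σ k) : ℝ) = 0 := by
    have hnn : ∀ k, 0 ≤ ω' k * inner ℝ x (σ k) := fun k => by
      rcases (hω' k).eq_or_lt with h0 | h0
      · rw [← h0, zero_mul]
      obtain ⟨-, -, ε, hε, hs⟩ := hdir' k h0
      have := nonpos_of_cos_mul_add_sin_mul_le (m := -inner ℝ x q) (g := -inner ℝ x (σ k)) hε
        fun s hs' => by
          have := hmax' x hx _ (hs s hs')
          simp only [inner_add_right, inner_smul_right] at this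
          linarith
      exact mul_nonneg h0.le (by linarith)
    have h0 : ∑ k, ω' k * (inner ℝ x (σ k) : ℝ) = 0 := by
      have := congrArg (fun v => (inner ℝ x v : ℝ)) hsum'
      simpa [inner_sum, inner_smul_right] using this
    intro k hk
    exact (mul_eq_zero.1 ((Finset.sum_eq_zero_iff_of_nonneg fun k _ => hnn k).1 h0 k
      (Finset.mem_univ k))).resolve_left hk.ne'
  -- among the balanced directions at `q` one does not point the same way as `τ k`
  obtain ⟨l, hl, hlτ⟩ : ∃ l, 0 < ω' l ∧ (inner ℝ (τ k) (σ l) : ℝ) ≤ 0 := by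
    by_contra! hcon
    have h0 : ∑ l, ω' l * (inner ℝ (τ k) (σ l) : ℝ) = 0 := by
      have := congrArg (fun v => (inner ℝ (τ k) v : ℝ)) hsum'
      simpa [inner_sum, inner_smul_right] using this
    refine (Finset.sum_pos' (fun l _ => ?_) ⟨k', Finset.mem_univ _, ?_⟩).ne' h0
    · rcases (hω' l).eq_or_lt with h | h
      · rw [← h, zero_mul]
      · exact (mul_pos h (hcon l h)).le
    · exact mul_pos hk' (hcon k' hk')
  obtain ⟨hτ1, hxτ, ε, hε, hs⟩ := hdir k hk
  obtain ⟨hσ1, hqσ, ε', hε', hs'⟩ := hdir' l hl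
  have hsq := inner_sq_eq_one_of_orthogonal hx1 hq1 hτ1 hσ1
    (by nlinarith) hxτ (hτq k hk)
    (hσx l hl) hqσ
  have hτσ : (inner ℝ (τ k) (σ l) : ℝ) = -1 := by
    rcases sq_eq_one_iff.1 hsq with h | h <;> linarith
  let s := min (min ε ε') 1
  have hs0 : 0 < s := lt_min (lt_min hε hε') one_pos
  have hsε : s ≤ ε := (min_le_left _ _).trans (min_le_left _ _)
  have hsε' : s ≤ ε' := (min_le_left _ _).trans (min_le_right _ _)
  have h1 := hmax' _ (hs s ⟨hs0.le, hsε⟩) _ (hs' s ⟨hs0.le, hsε'⟩)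
  simp only [inner_add_left, inner_add_right, inner_smul_left, inner_smul_right, conj_trivial,
    hσx l hl, real_inner_comm q (τ k), hτq k hk, hτσ] at h1
  have hsin : 0 < Real.sin s :=
    Real.sin_pos_of_pos_of_lt_pi hs0 ((min_le_right _ _).trans_lt (by linarith [Real.pi_gt_three]))
  nlinarith [Real.sin_sq_add_cos_sq s, mul_pos (mul_pos hsin hsin) (by linarith : 0 < 1 + (inner ℝ x q : ℝ))]

/-! ### A stress forces length at least `2π`, with equality for rings only -/

/-- A vector at the right distances from two points of a great circle lies on that circle. -/
theorem eq_of_inner_eq {p T x y : E3} {α ℓ : ℝ} (hp : ‖p‖ = 1) (hT : ‖T‖ = 1)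
    (hpT : inner ℝ p T = 0) (hy : ‖y‖ = 1) (hα : Real.sin α ≠ 0)
    (hx : x = Real.cos α • p + Real.sin α • T) (hpy : inner ℝ p y = Real.cos (α + ℓ))
    (hxy : inner ℝ x y = Real.cos ℓ) :
    y = Real.cos (α + ℓ) • p + Real.sin (α + ℓ) • T := by
  have h1 : Real.cos ℓ = Real.cos α * Real.cos (α + ℓ) + Real.sin α * inner ℝ T y := by
    rw [← hxy, hx, inner_add_left, inner_smul_left, inner_smul_left, hpy]
    rfl
  have h2 : Real.cos ℓ = Real.cos (α + ℓ) * Real.cos α + Real.sin (α + ℓ) * Real.sin α := by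
    rw [← Real.cos_sub, add_sub_cancel_left]
  have hTy : (inner ℝ T y : ℝ) = Real.sin (α + ℓ) :=
    mul_left_cancel₀ hα (by linarith)
  refine (inner_eq_one_iff_of_norm_eq_one (𝕜 := ℝ) hy
    (norm_cos_smul_add_sin_smul hp hT hpT (α + ℓ))).1 ?_
  rw [inner_add_right, inner_smul_right, inner_smul_right, real_inner_comm p, real_inner_comm T,
    hpy, hTy]
  linarith [Real.sin_sq_add_cos_sq (α + ℓ)]

theorem angle_eq_of_inner_eq_cos {x y : E3} (hx : ‖x‖ = 1) (hy : ‖y‖ = 1) {a : ℝ} (h0 : 0 ≤ a)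
    (hπ : a ≤ Real.pi) (h : inner ℝ x y = Real.cos a) : InnerProductGeometry.angle x y = a := by
  rw [InnerProductGeometry.angle, hx, hy, h]
  simpa using Real.arccos_cos h0 hπ

theorem inner_eq_cos_of_angle_eq {x y : E3} (hx : ‖x‖ = 1) (hy : ‖y‖ = 1) {a : ℝ}
    (h : InnerProductGeometry.angle x y = a) : inner ℝ x y = Real.cos a := by
  rw [← h, InnerProductGeometry.cos_angle, hx, hy]
  simp

/-- Points at consecutive angles `ℓ`, whose angles to `p` grow by `ℓ` in each step, continue the
great circle on which the first one lies. -/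
theorem eq_cos_add_sin_of_steps {p T : E3} {α ℓ : ℝ} {m : ℕ} {x : ℕ → E3} (hp : ‖p‖ = 1)
    (hT : ‖T‖ = 1) (hpT : inner ℝ p T = 0) (hα : 0 < α) (hℓ : 0 < ℓ) (hx : ∀ t ≤ m, ‖x t‖ = 1)
    (h0 : x 0 = Real.cos α • p + Real.sin α • T)
    (hstep : ∀ t < m, inner ℝ (x t) (x (t + 1)) = Real.cos ℓ)
    (hang : ∀ t ≤ m, InnerProductGeometry.angle p (x t) = α + t * ℓ) {t : ℕ} (ht : t ≤ m) :
    x t = Real.cos (α + t * ℓ) • p + Real.sin (α + t * ℓ) • T := by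
  induction t with
  | zero => simpa using h0
  | succ t ih =>
    have hα' : 0 < α + t * ℓ := by positivity
    have hle : α + (t + 1 : ℕ) * ℓ ≤ Real.pi := hang _ ht ▸ InnerProductGeometry.angle_le_pi _ _
    have e : α + (t + 1 : ℕ) * ℓ = α + t * ℓ + ℓ := by push_cast; ring
    rw [e] at hle ⊢
    refine eq_of_inner_eq hp hT hpT (hx _ ht)
      (Real.sin_pos_of_pos_of_lt_pi hα' (by linarith)).ne' (ih (by omega)) ?_ (hstep t (by omega))
    rw [← e]
    exact inner_eq_cos_of_angle_eq hp (hx _ ht) (hang _ ht)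

theorem le_add_of_steps {d : ℕ → ℝ} {ℓ : ℝ} {a b : ℕ}
    (h : ∀ t, a ≤ t → t < b → d (t + 1) ≤ d t + ℓ) (hab : a ≤ b) :
    d b ≤ d a + ((b : ℝ) - a) * ℓ := by
  induction b, hab using Nat.le_induction with
  | base => simp
  | succ b hab ih =>
    have h1 := h b hab (by omega)
    have h2 := ih fun t h1 h2 => h t h1 (by omega)
    push_cast
    linarith

theorem le_add_of_steps_rev {d : ℕ → ℝ} {ℓ : ℝ} {a b : ℕ}
    (h : ∀ t, a ≤ t → t < b → d t ≤ d (t + 1) + ℓ) (hab : a ≤ b) :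
    d a ≤ d b + ((b : ℝ) - a) * ℓ := by
  induction b, hab using Nat.le_induction with
  | base => simp
  | succ b hab ih =>
    have h1 := h b hab (by omega)
    have h2 := ih fun t h1 h2 => h t h1 (by omega)
    push_cast
    linarith

/-- A closed equilateral polygon through `p` and `-p` has length at least `2π`; in the extremal
case the angles from `p` increase, and then decrease, at full speed. -/
theorem polygon_angles {x : ℕ → E3} {p : E3} {n a : ℕ} {ℓ s s' : ℝ} (han : a + 1 < n)
    (hstep : ∀ t, t + 1 < n → InnerProductGeometry.angle (x t) (x (t + 1)) = ℓ)
    (h0 : InnerProductGeometry.angle p (x 0) = s)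
    (hn : InnerProductGeometry.angle p (x (n - 1)) = ℓ - s)
    (ha : InnerProductGeometry.angle (-p) (x a) = s')
    (ha' : InnerProductGeometry.angle (-p) (x (a + 1)) = ℓ - s') (hle : n * ℓ ≤ 2 * Real.pi) :
    n * ℓ = 2 * Real.pi ∧
      (∀ t ≤ a, InnerProductGeometry.angle p (x t) = s + t * ℓ) ∧
      ∀ t, a < t → t < n → InnerProductGeometry.angle p (x t) = ((n : ℝ) - t) * ℓ - s := by
  set d : ℕ → ℝ := fun t => InnerProductGeometry.angle p (x t) with hd
  have hup : ∀ t, t + 1 < n → d (t + 1) ≤ d t + ℓ := fun t ht => by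
    rw [← hstep t ht]; exact InnerProductGeometry.angle_le_angle_add_angle _ _ _
  have hdown : ∀ t, t + 1 < n → d t ≤ d (t + 1) + ℓ := fun t ht => by
    rw [← hstep t ht, InnerProductGeometry.angle_comm (x t)]
    exact InnerProductGeometry.angle_le_angle_add_angle _ _ _
  rw [InnerProductGeometry.angle_neg_left] at ha ha'
  change d 0 = s at h0
  change d (n - 1) = _ at hn
  change Real.pi - d a = _ at ha
  change Real.pi - d (a + 1) = _ at ha'
  have hcast : ((n - 1 : ℕ) : ℝ) = n - 1 := by
    rw [Nat.cast_sub (by omega)]; simp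
  have h1 := le_add_of_steps (a := 0) (b := a) (fun t _ ht => hup t (by omega)) (Nat.zero_le _)
  have h2 := le_add_of_steps_rev (a := a + 1) (b := n - 1)
    (fun t _ ht => hdown t (by omega)) (by omega)
  rw [hcast] at h2
  push_cast at h1 h2
  have heq : n * ℓ = 2 * Real.pi := by linarith
  refine ⟨heq, fun t ht => ?_, fun t ht htn => ?_⟩
  · have h3 := le_add_of_steps (a := 0) (b := t) (fun t _ ht => hup t (by omega)) (Nat.zero_le _)
    have h4 := le_add_of_steps (a := t) (b := a) (fun t _ ht => hup t (by omega)) ht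
    change d t = _
    push_cast at h3
    linarith
  · have h3 := le_add_of_steps_rev (a := a + 1) (b := t)
      (fun t _ ht => hdown t (by omega)) (by omega)
    have h4 := le_add_of_steps_rev (a := t) (b := n - 1)
      (fun t _ ht => hdown t (by omega)) (by omega)
    rw [hcast] at h4
    push_cast at h3
    change d t = _
    linarith

/-- A stressed simple cycle through two antipodal points, on edges `i j` and `k l`, consists of all
`N` points, equally spaced on a great circle. -/
theorem IsStress.eq_ring_of_path {N : ℕ} {u : Fin N → E3} (hu : ∀ i, ‖u i‖ = 1) {ℓ : ℝ}
    (hℓ0 : 0 < ℓ) (hℓπ : ℓ < Real.pi) {w : Fin N → Fin N → ℝ} (hw : IsStress u (Real.cos ℓ) w)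
    (hN : N * ℓ ≤ 2 * Real.pi) {i j k l : Fin N} {s s' : ℝ} (hij : w i j ≠ 0) (hs : 0 ≤ s)
    (hsℓ : s < ℓ) (hkl : w k l ≠ 0) (hs' : s' ∈ Set.Icc 0 ℓ)
    (hanti : arcPoint ℓ (u k) (u l) s' = -arcPoint ℓ (u i) (u j) s) {A B : List (Fin N)}
    (hch : (A ++ k :: l :: B).IsChain fun i j => w i j ≠ 0) (hnd : (A ++ k :: l :: B).Nodup)
    (hhead : (A ++ k :: l :: B).head? = some i) (hlast : (A ++ k :: l :: B).getLast? = some j) :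
    N * ℓ = 2 * Real.pi ∧ ∃ e f : E3, ‖e‖ = 1 ∧ ‖f‖ = 1 ∧ inner ℝ e f = 0 ∧
      ∃ σ : Equiv.Perm (Fin N), ∀ t : Fin N,
        u (σ t) = Real.cos (t * ℓ) • e + Real.sin (t * ℓ) • f := by
  have hsin : 0 < Real.sin ℓ := Real.sin_pos_of_pos_of_lt_pi hℓ0 hℓπ
  set P := A ++ k :: l :: B with hP
  set n := P.length with hn
  set a := A.length with ha
  have hna : a + 1 < n := by simp [hn, hP, ha]
  have hnN : n ≤ N := by simpa using hnd.length_le_card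
  -- positions along the cycle
  let v : ℕ → Fin N := fun t => P.getD t i
  have hv : ∀ t (ht : t < n), v t = P[t] := fun t ht => List.getD_eq_getElem _ _ ht
  have hv0 : v 0 = i := by
    rw [hv 0 (by omega)]
    rw [List.head?_eq_getElem?, List.getElem?_eq_getElem (by omega)] at hhead
    simpa using hhead
  have hvn : v (n - 1) = j := by
    rw [hv _ (by omega)]
    rw [List.getLast?_eq_getElem?, List.getElem?_eq_getElem (by omega)] at hlast
    simpa using hlast
  have hva : v a = k := by
    rw [hv _ (by omega)]
    simp [hP, ha]
  have hva' : v (a + 1) = l := by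
    rw [hv _ (by omega)]
    simp [hP, ha]
  have hadj : ∀ t, t + 1 < n → w (v t) (v (t + 1)) ≠ 0 := fun t ht => by
    rw [hv _ (by omega), hv _ ht]
    exact List.isChain_iff_getElem.1 hch t ht
  have hinj : ∀ t t', t < n → t' < n → v t = v t' → t = t' := fun t t' ht ht' h => by
    rw [hv _ ht, hv _ ht'] at h
    exact (hnd.getElem_inj_iff).1 h
  have hcij := (hw.contact i j hij).2
  have hckl := (hw.contact k l hkl).2
  -- `p` lies on the edge from `i` to `j`, and `T` points from it towards `i`
  set p := arcPoint ℓ (u i) (u j) s with hpdef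
  set T := -arcVel ℓ (u i) (u j) s with hTdef
  have hp : ‖p‖ = 1 := norm_arcPoint hsin.ne' (hu i) (hu j) hcij s
  have hT : ‖T‖ = 1 := by
    rw [hTdef, norm_neg, arcVel_eq]; exact norm_arcPoint hsin.ne' (hu i) (hu j) hcij _
  have hpT : inner ℝ p T = 0 := by
    rw [hTdef, inner_neg_right, inner_arcPoint_arcVel hsin.ne' (hu i) (hu j) hcij, neg_zero]
  have hx0 : u (v 0) = Real.cos s • p + Real.sin s • T := by
    have := arcPoint_add (ℓ := ℓ) (x := u i) (y := u j) s (-s)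
    rw [add_neg_cancel, arcPoint_zero] at this
    rw [hv0, this, hTdef, hpdef]
    simp
  have hxn : u (v (n - 1)) = Real.cos (ℓ - s) • p + Real.sin (ℓ - s) • (-T) := by
    have := arcPoint_add (ℓ := ℓ) (x := u i) (y := u j) s (ℓ - s)
    rw [add_sub_cancel, arcPoint_end hsin.ne'] at this
    rw [hvn, this, hTdef, neg_neg]
  have inner_ray : ∀ {q S : E3} (r : ℝ), ‖q‖ = 1 → inner ℝ q S = 0 →
      inner ℝ q (Real.cos r • q + Real.sin r • S) = Real.cos r := fun r h1 h2 => by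
    simp [inner_add_right, inner_smul_right, h1, h2]
  have hpT' : inner ℝ p (-T) = 0 := by rw [inner_neg_right, hpT, neg_zero]
  -- angles from `p` and from `-p`
  have hstep : ∀ t, t + 1 < n → inner ℝ (u (v t)) (u (v (t + 1))) = Real.cos ℓ := fun t ht =>
    (hw.contact _ _ (hadj t ht)).2
  have hq : ‖-p‖ = 1 := by rwa [norm_neg]
  have hka : InnerProductGeometry.angle (-p) (u (v a)) = s' := by
    refine angle_eq_of_inner_eq_cos hq (hu _) hs'.1 (hs'.2.trans hℓπ.le) ?_
    rw [← hanti, hva, real_inner_comm]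
    exact inner_ray s' (hu k) (inner_edgeDir (hu k) hckl)
  have hla : InnerProductGeometry.angle (-p) (u (v (a + 1))) = ℓ - s' := by
    refine angle_eq_of_inner_eq_cos hq (hu _) (by linarith [hs'.2]) (by linarith [hs'.1]) ?_
    rw [← hanti, hva', ← arcPoint_swap hsin.ne', real_inner_comm]
    exact inner_ray (ℓ - s') (hu l) (inner_edgeDir (hu l) (by rw [real_inner_comm, hckl]))
  obtain ⟨heq, hang, hang'⟩ := polygon_angles (x := fun t => u (v t)) (p := p) (s := s) (s' := s')
    hna (fun t ht => angle_eq_of_inner_eq_cos (hu _) (hu _) hℓ0.le hℓπ.le (hstep t ht))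
    (angle_eq_of_inner_eq_cos hp (hu _) hs (by linarith) (by rw [hx0]; exact inner_ray s hp hpT))
    (angle_eq_of_inner_eq_cos hp (hu _) (by linarith) (by linarith)
      (by rw [hxn]; exact inner_ray _ hp hpT'))
    hka hla ((mul_le_mul_of_nonneg_right (by exact_mod_cast hnN) hℓ0.le).trans hN)
  have hNn : N = n := by
    refine le_antisymm ?_ hnN
    have : (N : ℝ) * ℓ ≤ n * ℓ := by linarith
    exact_mod_cast le_of_mul_le_mul_right this hℓ0
  -- the second half of the cycle, traversed backwards from `j`
  have hback : ∀ t, a < t → t < n →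
      u (v t) = Real.cos (s + t * ℓ) • p + Real.sin (s + t * ℓ) • T := by
    intro t hat htn
    have := eq_cos_add_sin_of_steps (x := fun r => u (v (n - 1 - r))) (m := n - 2 - a) (α := ℓ - s)
      hp (by rwa [norm_neg]) hpT' (by linarith) hℓ0 (fun _ _ => hu _) hxn
      (fun r hr => by
        have e : n - 1 - r = n - 1 - (r + 1) + 1 := by omega
        rw [e, real_inner_comm]
        exact hstep _ (by omega))
      (fun r hr => by
        have := hang' (n - 1 - r) (by omega) (by omega)
        rw [this, Nat.cast_sub (by omega), Nat.cast_sub (by omega)]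
        push_cast
        ring) (t := n - 1 - t) (by omega)
    have e : n - 1 - (n - 1 - t) = t := by omega
    have e' : ℓ - s + ((n - 1 - t : ℕ) : ℝ) * ℓ = 2 * Real.pi - (s + t * ℓ) := by
      rw [← heq, Nat.cast_sub (by omega), Nat.cast_sub (by omega)]
      push_cast
      ring
    rw [e, e', Real.cos_two_pi_sub, Real.sin_two_pi_sub] at this
    rw [this]
    simp
  have hforth : ∀ t ≤ a, u (v t) = Real.cos (s + t * ℓ) • p + Real.sin (s + t * ℓ) • T := by
    rcases hs.eq_or_lt with hs0 | hs0
    swap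
    · intro t ht
      exact eq_cos_add_sin_of_steps (x := fun r => u (v r)) (m := a) hp hT hpT hs0 hℓ0
        (fun _ _ => hu _) hx0 (fun r hr => hstep r (by omega)) hang ht
    -- here `p` is the vertex `i`, and the balance of the tensions at `i` is needed
    subst hs0
    have hxp : u i = p := by rw [hpdef, arcPoint_zero]
    intro t ht
    rcases Nat.eq_zero_or_pos t with rfl | htpos
    · simpa using hx0
    have ha1 : 1 ≤ a := by omega
    have hc1 : inner ℝ p (u (v 1)) = Real.cos ℓ := by
      have := hstep 0 (by omega)
      rwa [hv0, hxp] at this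
    set T' := edgeDir ℓ p (u (v 1)) with hT'
    have hT'1 : ‖T'‖ = 1 := norm_edgeDir hsin.ne' hp (hu _) hc1
    have hx1 : u (v 1) = Real.cos ℓ • p + Real.sin ℓ • T' := (arcPoint_end hsin.ne').symm
    have hTT : T' = T := by
      have hbal := hw.balanced i
      have hsub : ({v 1, j} : Finset (Fin N)) ⊆ Finset.univ := Finset.subset_univ _
      have hv1j : v 1 ≠ j := fun h => by
        rw [← hvn] at h
        have := hinj 1 (n - 1) (by omega) (by omega) h
        omega
      rw [← Finset.sum_subset hsub, Finset.sum_pair hv1j] at hbal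
      · have h1 : w i (v 1) ≠ 0 := by
          have := hadj 0 (by omega)
          rwa [hv0] at this
        rw [hxp, hx1, ← hvn, hxn, sub_zero, hvn, add_sub_cancel_left, add_sub_cancel_left, smul_neg,
          smul_neg, ← sub_eq_add_neg, sub_eq_zero, smul_comm, smul_comm (w i j)] at hbal
        have hbal' := smul_right_injective E3 hsin.ne' hbal
        have hnorm := congrArg norm hbal'
        rw [norm_smul, norm_smul, hT'1, hT, mul_one, mul_one, Real.norm_of_nonneg (hw.nonneg _ _),
          Real.norm_of_nonneg (hw.nonneg _ _)] at hnorm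
        rw [hnorm] at hbal'
        exact smul_right_injective E3 hij hbal'
      · intro m _ hm
        by_cases hwm : w i m = 0
        · rw [hwm, zero_smul]
        exfalso
        have hangm : InnerProductGeometry.angle p (u m) = ℓ :=
          angle_eq_of_inner_eq_cos hp (hu _) hℓ0.le hℓπ.le
            (by rw [← hxp]; exact (hw.contact i m hwm).2)
        obtain ⟨r, hr, rfl⟩ : ∃ r, r < n ∧ v r = m := by
          have hcard : P.toFinset = Finset.univ := by
            rw [← Finset.card_eq_iff_eq_univ, List.toFinset_card_of_nodup hnd, Fintype.card_fin]
            exact hNn.symm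
          have hmem : m ∈ P := by
            rw [← List.mem_toFinset, hcard]; exact Finset.mem_univ _
          obtain ⟨r, hr, h⟩ := List.getElem_of_mem hmem
          exact ⟨r, hr, by rw [hv r hr, h]⟩
        refine hm (Finset.mem_insert.2 ?_)
        rcases le_or_gt r a with h | h
        · left
          have h2 := hang r h
          simp only [hangm, zero_add] at h2
          have : (r : ℝ) = 1 := by
            have h3 : (r : ℝ) * ℓ = 1 * ℓ := by linarith
            exact mul_right_cancel₀ hℓ0.ne' h3
          have : r = 1 := by exact_mod_cast this
          rw [this]
        · right
          have h2 := hang' r h hr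
          simp only [hangm, sub_zero] at h2
          have h3 : ((n : ℝ) - r) = 1 := mul_right_cancel₀ hℓ0.ne' (by linarith)
          have h4 : n = r + 1 := by
            have : (n : ℝ) = ((r + 1 : ℕ) : ℝ) := by push_cast; linarith
            exact_mod_cast this
          have : r = n - 1 := by omega
          rw [Finset.mem_singleton, this, hvn]
    rw [hTT] at hx1
    have := eq_cos_add_sin_of_steps (x := fun r => u (v (r + 1))) (m := a - 1) (α := ℓ)
      hp hT hpT hℓ0 hℓ0 (fun _ _ => hu _) hx1 (fun r hr => hstep (r + 1) (by omega))
      (fun r hr => by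
        have := hang (r + 1) (by omega)
        rw [this]; push_cast; ring) (t := t - 1) (by omega)
    have e : t - 1 + 1 = t := by omega
    have e' : ℓ + ((t - 1 : ℕ) : ℝ) * ℓ = 0 + t * ℓ := by
      rw [Nat.cast_sub (by omega)]; push_cast; ring
    rwa [e, e'] at this
  refine ⟨by rw [hNn]; exact heq, Real.cos s • p + Real.sin s • T,
    -Real.sin s • p + Real.cos s • T, norm_cos_smul_add_sin_smul hp hT hpT s, ?_, ?_, ?_⟩
  · have := norm_cos_smul_add_sin_smul hp hT hpT (s + Real.pi / 2)
    rwa [Real.cos_add_pi_div_two, Real.sin_add_pi_div_two] at this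
  · have hTp : inner ℝ T p = (0 : ℝ) := by rw [real_inner_comm, hpT]
    simp only [inner_add_left, inner_add_right, inner_smul_left, inner_smul_right, hpT, hTp,
      real_inner_self_eq_norm_sq, hp, hT]
    simp
    ring
  · have hbij : Function.Bijective fun t : Fin N => v t := by
      refine (Finite.injective_iff_bijective).1 fun t t' h => Fin.ext ?_
      exact hinj t t' (hNn ▸ t.2) (hNn ▸ t'.2) h
    refine ⟨Equiv.ofBijective _ hbij, fun t => ?_⟩
    have : u (v t) = Real.cos (s + t * ℓ) • p + Real.sin (s + t * ℓ) • T := by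
      rcases le_or_gt (t : ℕ) a with h | h
      · exact hforth t h
      · exact hback t h (hNn ▸ t.2)
    rw [Equiv.ofBijective_apply, this, Real.cos_add, Real.sin_add]
    module

/-- If the contact graph of `N` unit vectors at contact angle `ℓ` carries a nonzero stress and
`N ℓ ≤ 2π`, the vectors are `N` equally spaced points on a great circle. -/
theorem IsStress.eq_ring {N : ℕ} {u : Fin N → E3} (hu : ∀ i, ‖u i‖ = 1) {ℓ : ℝ} (hℓ0 : 0 < ℓ)
    (hℓπ : ℓ < Real.pi) {w : Fin N → Fin N → ℝ} (hw : IsStress u (Real.cos ℓ) w) (hw0 : w ≠ 0)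
    (hN : N * ℓ ≤ 2 * Real.pi) :
    N * ℓ = 2 * Real.pi ∧ ∃ e f : E3, ‖e‖ = 1 ∧ ‖f‖ = 1 ∧ inner ℝ e f = 0 ∧
      ∃ σ : Equiv.Perm (Fin N), ∀ t : Fin N,
        u (σ t) = Real.cos (t * ℓ) • e + Real.sin (t * ℓ) • f := by
  obtain ⟨w, hmin⟩ := hw.exists_minimal hw0
  have hst := hmin.toIsStress
  have hsin : Real.sin ℓ ≠ 0 := (Real.sin_pos_of_pos_of_lt_pi hℓ0 hℓπ).ne'
  have hsymm : ∀ {i j}, w i j ≠ 0 → w j i ≠ 0 := fun h => by rwa [hst.symm]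
  obtain ⟨a, b, hab⟩ : ∃ a b, w a b ≠ 0 := by
    by_contra! h
    exact hmin.ne_zero (funext fun a => funext fun b => h a b)
  have hunit : ∀ x ∈ stressGraph u ℓ w, ‖x‖ = 1 := by
    rintro x ⟨i, j, s, hij, -, rfl⟩
    exact norm_arcPoint hsin (hu i) (hu j) (hst.contact i j hij).2 s
  obtain ⟨x, ⟨i, j, s, hij, hs, rfl⟩, ⟨k, l, s', hkl, hs', hanti⟩⟩ := exists_antipodal
    (isCompact_stressGraph u ℓ w) hunit (fun x hx => hst.hasBalancedDirections hu hℓ0 hℓπ hx)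
    ⟨u a, ⟨a, b, 0, hab, ⟨le_rfl, hℓ0.le⟩, arcPoint_zero⟩,
      u b, ⟨a, b, ℓ, hab, ⟨hℓ0.le, le_rfl⟩, arcPoint_end hsin⟩, fun h => by
        have h1 := (hst.contact a b hab).2
        rw [← h, real_inner_self_eq_norm_sq, hu, one_pow] at h1
        have h2 := Real.sin_sq_add_cos_sq ℓ
        rw [← h1] at h2
        exact hsin ((pow_eq_zero_iff two_ne_zero).1 (by linarith))⟩
  obtain ⟨P, hch, hnd, hhead, hlast, A, B, hP⟩ := hmin.exists_path hu hij hkl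
  -- orient the second edge along the path
  obtain ⟨k, l, s', hkl, hs', hanti, rfl⟩ : ∃ k l s', w k l ≠ 0 ∧ s' ∈ Set.Icc 0 ℓ ∧
      arcPoint ℓ (u k) (u l) s' = -arcPoint ℓ (u i) (u j) s ∧ P = A ++ k :: l :: B := by
    rcases hP with rfl | rfl
    · exact ⟨k, l, s', hkl, hs', hanti, rfl⟩
    · exact ⟨l, k, ℓ - s', hsymm hkl, ⟨by linarith [hs'.2], by linarith [hs'.1]⟩,
        by rw [arcPoint_swap hsin, hanti], rfl⟩
  rcases hs.2.lt_or_eq with hsℓ | rfl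
  · exact hst.eq_ring_of_path hu hℓ0 hℓπ hN hij hs.1 hsℓ hkl hs' hanti hch hnd hhead hlast
  · -- the antipodal point is the end of the first edge: reverse all orientations
    have hrev : (A ++ k :: l :: B).reverse = B.reverse ++ l :: k :: A.reverse := by simp
    refine hst.eq_ring_of_path hu hℓ0 hℓπ hN (i := j) (j := i) (k := l) (l := k) (s := 0)
      (s' := s - s') (A := B.reverse) (B := A.reverse) (hsymm hij) le_rfl hℓ0 (hsymm hkl)
      ⟨by linarith [hs'.2], by linarith [hs'.1]⟩ ?_ ?_ ?_ ?_ ?_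
    · rw [arcPoint_swap hsin, hanti, arcPoint_end hsin, arcPoint_zero]
    · rw [← hrev, List.isChain_reverse]
      exact hch.imp fun _ _ h => hsymm h
    · rw [← hrev]; exact List.nodup_reverse.2 hnd
    · rw [← hrev, List.head?_reverse, hlast]
    · rw [← hrev, List.getLast?_reverse, hhead]

/-! ### Critical configurations -/

theorem Conf.norm_vec {N : ℕ} (U : Conf N) (i : Fin N) : ‖U.vec i‖ = 1 := by
  simp [Conf.vec]

theorem Conf.gramArray_lt_one {N : ℕ} (U : Conf N) {i j : Fin N} (hij : i ≠ j) :
    gramArray U.vec i j < 1 :=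
  (inner_lt_one_iff_real_of_norm_eq_one (U.norm_vec i) (U.norm_vec j)).2 fun h =>
    hij (U.2 (Subtype.ext h))

/-- The cosine of the smallest angle of a configuration. -/
noncomputable def Conf.mu {N : ℕ} (U : Conf N) : ℝ := maxOffDiag (gramArray U.vec)

theorem Conf.rho_eq {N : ℕ} (hN : 2 ≤ N) (U : Conf N) : U.rho = 1 / 2 * Real.arccos U.mu :=
  injRadius_eq hN U.norm_vec

theorem Conf.mu_lt_one {N : ℕ} (hN : 2 ≤ N) (U : Conf N) : U.mu < 1 := by
  obtain ⟨i, j, hij, e⟩ := exists_eq_maxOffDiag hN (gramArray U.vec)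
  rw [Conf.mu, ← e]
  exact U.gramArray_lt_one hij

theorem Conf.neg_one_le_mu {N : ℕ} (hN : 2 ≤ N) (U : Conf N) : -1 ≤ U.mu :=
  (maxOffDiag_mem_Icc hN U.norm_vec).1

/-- The strict first order condition on the closest pairs, made robust: the pairs that are not
closest are allowed a derivative proportional to their slack. -/
theorem exists_rate {N : ℕ} {M D : Fin N → Fin N → ℝ}
    (h : ∀ i j, i ≠ j → M i j = maxOffDiag M → D i j < 0) :
    ∃ κ > 0, ∃ L > 0, ∀ i j, i ≠ j → D i j + κ < L * (maxOffDiag M - M i j) := by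
  have key : ∀ i j, i ≠ j → ∀ᶠ n : ℕ in Filter.atTop,
      D i j + 1 / ((n : ℝ) + 1) < ((n : ℝ) + 1) * (maxOffDiag M - M i j) := by
    intro i j hij
    have h1 : Filter.Tendsto (fun n : ℕ => D i j + 1 / ((n : ℝ) + 1)) Filter.atTop
        (𝓝 (D i j)) := by
      simpa using (tendsto_const_nhds (x := D i j)).add
        (tendsto_one_div_add_atTop_nhds_zero_nat (𝕜 := ℝ))
    rcases (le_maxOffDiag M hij).eq_or_lt with he | hlt
    · filter_upwards [h1.eventually_lt_const (h i j hij he)] with n hn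
      rw [he]
      simpa using hn
    · have h2 : Filter.Tendsto (fun n : ℕ => ((n : ℝ) + 1) * (maxOffDiag M - M i j)) Filter.atTop
          Filter.atTop :=
        (Filter.tendsto_atTop_add_const_right _ _ tendsto_natCast_atTop_atTop).atTop_mul_const
          (sub_pos.2 hlt)
      filter_upwards [h1.eventually_lt_const (lt_add_one _),
        h2.eventually_gt_atTop (D i j + 1)] with n hn hn'
      exact hn.trans hn'
  have key' : ∀ᶠ n : ℕ in Filter.atTop, ∀ i j, i ≠ j →
      D i j + 1 / ((n : ℝ) + 1) < ((n : ℝ) + 1) * (maxOffDiag M - M i j) := by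
    simp only [Filter.eventually_all]
    exact fun i j hij => key i j hij
  obtain ⟨n, hn⟩ := key'.exists
  exact ⟨1 / (n + 1), by positivity, n + 1, by positivity, hn⟩

/-- The derivative of the inner products in the direction of a tuple of vectors. -/
noncomputable def gramDeriv {N : ℕ} (u v : Fin N → E3) (i j : Fin N) : ℝ :=
  inner ℝ (u i) (v j) + inner ℝ (v i) (u j)

/-- A quantitative decrease of the largest inner product under a variation. -/
theorem maxOffDiag_vary_le {N : ℕ} (hN : 2 ≤ N) {u v : Fin N → E3} (hu : ∀ i, ‖u i‖ = 1)
    (hv : IsTangent u v) {κ L B s : ℝ}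
    (hD : ∀ i j, i ≠ j → gramDeriv u v i j + κ ≤ L * (maxOffDiag (gramArray u) - gramArray u i j))
    (hB : ∀ i j, ‖v i‖ ^ 2 + ‖v j‖ ^ 2 ≤ B) (hs : 0 ≤ s) (hsL : s * L ≤ 1) (hsB : s * B ≤ κ / 2) :
    maxOffDiag (gramArray (vary u v s)) ≤ maxOffDiag (gramArray u) - s * (κ / 2) := by
  refine maxOffDiag_le hN fun i j hij => ?_
  have h1 := (abs_le.1 (abs_gramArray_vary_sub_le hu hv s i j)).2
  have h2 := mul_le_mul_of_nonneg_left (hD i j hij) hs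
  have h3 := mul_le_mul_of_nonneg_left (hB i j) (sq_nonneg s)
  have h4 := mul_le_mul_of_nonneg_left hsB hs
  have h5 := mul_nonneg (sub_nonneg.2 hsL) (sub_nonneg.2 (le_maxOffDiag (gramArray u) hij))
  simp only [gramDeriv] at h2
  nlinarith

/-- A variation that increases all the smallest angles to first order contradicts criticality. -/
theorem Conf.not_isCritical_of_expanding {N : ℕ} (hN : 2 ≤ N) {U : Conf N} {v : Fin N → E3}
    (hv : IsTangent U.vec v)
    (h : ∀ i j, i ≠ j → gramArray U.vec i j = U.mu → gramDeriv U.vec v i j < 0) :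
    ¬ U.IsCritical := by
  intro hcrit
  obtain ⟨κ, hκ, L, hL, hrate⟩ := exists_rate h
  obtain ⟨B, hB0, hB⟩ : ∃ B > 0, ∀ i j, ‖v i‖ ^ 2 + ‖v j‖ ^ 2 ≤ B := by
    obtain ⟨B, hB⟩ := (Set.finite_range fun p : Fin N × Fin N => ‖v p.1‖ ^ 2 + ‖v p.2‖ ^ 2).bddAbove
    exact ⟨max B 1, by positivity, fun i j =>
      (hB ⟨(i, j), rfl⟩).trans (le_max_left _ _)⟩
  have h1 := ((hcrit v hv).bound (by positivity : 0 < κ / 8)).filter_mono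
    (nhdsWithin_le_nhds (s := Set.Ioi 0))
  have h2 : ∀ᶠ s : ℝ in 𝓝[>] 0, s < min (1 / L) (κ / 2 / B) :=
    nhdsWithin_le_nhds (Iio_mem_nhds (by positivity))
  obtain ⟨s, ⟨hs1, hs2⟩, hs0⟩ := ((h1.and h2).and self_mem_nhdsWithin).exists
  have hs0' : 0 < s := hs0
  have hsL : s * L ≤ 1 := ((lt_div_iff₀ hL).1 (hs2.trans_le (min_le_left _ _))).le
  have hsB : s * B ≤ κ / 2 := ((lt_div_iff₀ hB0).1 (hs2.trans_le (min_le_right _ _))).le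
  have h3 := maxOffDiag_vary_le hN U.norm_vec hv (fun i j hij => (hrate i j hij).le) hB hs0'.le
    hsL hsB
  have h4 := (maxOffDiag_mem_Icc hN (norm_vary U.norm_vec hv s)).1
  have h5 := add_arccos_le (x := U.mu) (y := s * (κ / 2)) (by positivity) (U.mu_lt_one hN).le
    (h4.trans h3)
  have h6 := Real.arccos_le_arccos h3
  rw [U.rho_eq hN, injRadius_eq hN (norm_vary U.norm_vec hv s), Real.norm_eq_abs, Real.norm_eq_abs,
    abs_of_nonneg (le_max_right _ _), abs_of_pos hs0'] at hs1
  have h7 := (le_max_left _ _).trans hs1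
  change Real.arccos (U.mu - _) ≤ _ at h6
  nlinarith [mul_pos hs0' hκ]

theorem Conf.IsCritical.exists_stress {N : ℕ} (hN : 2 ≤ N) {U : Conf N} (h : U.IsCritical) :
    ∃ w, IsStress U.vec U.mu w ∧ w ≠ 0 := by
  by_contra! hcon
  obtain ⟨v, hv, hD⟩ := exists_expanding_of_no_stress U.norm_vec hcon
  exact Conf.not_isCritical_of_expanding hN hv hD h

/-- A stress on the contact graph of a configuration with `ρ ≤ π / N` exists for rings only. -/
theorem Conf.isNRing_of_stress {N : ℕ} (hN : 3 ≤ N) {U : Conf N} {w : Fin N → Fin N → ℝ}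
    (hw : IsStress U.vec U.mu w) (hw0 : w ≠ 0) (hle : U.rho ≤ Real.pi / N) :
    U.rho = Real.pi / N ∧ U.IsNRing := by
  have hN0 : (0 : ℝ) < N := by exact_mod_cast (by omega : 0 < N)
  have hN3 : (3 : ℝ) ≤ N := by exact_mod_cast hN
  rw [U.rho_eq (by omega), le_div_iff₀ hN0] at hle
  have hℓ0 : 0 < Real.arccos U.mu := Real.arccos_pos.2 (U.mu_lt_one (by omega))
  have hℓπ : Real.arccos U.mu < Real.pi := by nlinarith [Real.pi_pos]
  have hcos : Real.cos (Real.arccos U.mu) = U.mu :=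
    Real.cos_arccos (U.neg_one_le_mu (by omega)) (U.mu_lt_one (by omega)).le
  rw [← hcos] at hw
  obtain ⟨heq, e, f, he, hf, hef, σ, hσ⟩ := hw.eq_ring U.norm_vec hℓ0 hℓπ hw0 (by linarith)
  have hℓ : Real.arccos U.mu = 2 * Real.pi / N := by
    rw [eq_div_iff hN0.ne']; linarith
  refine ⟨by rw [U.rho_eq (by omega), hℓ]; ring, e, f, he, hf, hef, σ, fun k => ?_⟩
  rw [hσ k, hℓ]
  ring_nf

/-! ### Rings -/

/-- The points of a ring, indexed by the natural numbers. -/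
noncomputable def ringPoint (N : ℕ) (e f : E3) (k : ℕ) : E3 :=
  Real.cos (2 * Real.pi * k / N) • e + Real.sin (2 * Real.pi * k / N) • f

theorem periodic_ringPoint {N : ℕ} (hN : 0 < N) (e f : E3) :
    Function.Periodic (ringPoint N e f) N := by
  intro k
  have hN' : (N : ℝ) ≠ 0 := by exact_mod_cast hN.ne'
  have : 2 * Real.pi * ((k + N : ℕ) : ℝ) / N = 2 * Real.pi * k / N + 2 * Real.pi := by
    push_cast; field_simp
  simp only [ringPoint, this, Real.cos_add_two_pi, Real.sin_add_two_pi]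

theorem ringPoint_add_ringPoint (N : ℕ) (e f : E3) (k : ℕ) :
    ringPoint N e f k + ringPoint N e f (k + 2) =
      (2 * Real.cos (2 * Real.pi / N)) • ringPoint N e f (k + 1) := by
  set a := 2 * Real.pi * ((k + 1 : ℕ) : ℝ) / N with ha
  set b := 2 * Real.pi / N with hb
  have h1 : 2 * Real.pi * (k : ℝ) / N = a - b := by rw [ha, hb]; push_cast; ring
  have h2 : 2 * Real.pi * ((k + 2 : ℕ) : ℝ) / N = a + b := by rw [ha, hb]; push_cast; ring
  simp only [ringPoint, h1, h2, ← ha, Real.cos_add, Real.sin_add, Real.cos_sub, Real.sin_sub]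
  module

theorem inner_ringPoint {N : ℕ} {e f : E3} (he : ‖e‖ = 1) (hf : ‖f‖ = 1) (hef : inner ℝ e f = 0)
    (k l : ℕ) : inner ℝ (ringPoint N e f k) (ringPoint N e f l) =
      Real.cos (2 * Real.pi * ((l : ℝ) - k) / N) := by
  have : 2 * Real.pi * ((l : ℝ) - k) / N = 2 * Real.pi * l / N - 2 * Real.pi * k / N := by ring
  have hfe : inner ℝ f e = (0 : ℝ) := by rw [real_inner_comm, hef]
  simp only [this, Real.cos_sub, ringPoint, inner_add_left, inner_add_right, inner_smul_left,
    inner_smul_right, hef, hfe, real_inner_self_eq_norm_sq, he, hf]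
  simp

theorem cos_le_of_lt {N : ℕ} (hN : 2 ≤ N) {k l : ℕ} (hkl : k < l) (hl : l < N) :
    Real.cos (2 * Real.pi * ((l : ℝ) - k) / N) ≤ Real.cos (2 * Real.pi / N) := by
  have hN0 : (0 : ℝ) < N := by exact_mod_cast (by omega : 0 < N)
  have h1 : (1 : ℝ) ≤ (l : ℝ) - k := by
    have : ((k + 1 : ℕ) : ℝ) ≤ l := by exact_mod_cast hkl
    push_cast at this; linarith
  have h2 : (l : ℝ) - k + 1 ≤ N := by
    have : ((l + 1 : ℕ) : ℝ) ≤ N := by exact_mod_cast hl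
    push_cast at this
    linarith [(Nat.cast_nonneg k : (0 : ℝ) ≤ k)]
  have hb0 : 0 ≤ 2 * Real.pi / N := by positivity
  have hge : 2 * Real.pi / N ≤ 2 * Real.pi * ((l : ℝ) - k) / N := by
    refine div_le_div_of_nonneg_right ?_ hN0.le
    nlinarith [Real.pi_pos]
  have hle : 2 * Real.pi * ((l : ℝ) - k) / N ≤ 2 * Real.pi - 2 * Real.pi / N := by
    rw [div_le_iff₀ hN0, sub_mul, div_mul_cancel₀ _ hN0.ne']
    nlinarith [Real.pi_pos]
  rcases le_total (2 * Real.pi * ((l : ℝ) - k) / N) Real.pi with h | h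
  · exact Real.cos_le_cos_of_nonneg_of_le_pi hb0 h hge
  · rw [← Real.cos_two_pi_sub]
    exact Real.cos_le_cos_of_nonneg_of_le_pi hb0 (by linarith) (by linarith)

theorem inner_ringPoint_le {N : ℕ} (hN : 2 ≤ N) {e f : E3} (he : ‖e‖ = 1) (hf : ‖f‖ = 1)
    (hef : inner ℝ e f = 0) {k l : Fin N} (hkl : k ≠ l) :
    inner ℝ (ringPoint N e f k) (ringPoint N e f l) ≤ Real.cos (2 * Real.pi / N) := by
  rcases lt_or_gt_of_ne hkl with h | h
  · rw [inner_ringPoint he hf hef]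
    exact cos_le_of_lt hN h l.2
  · rw [real_inner_comm, inner_ringPoint he hf hef]
    exact cos_le_of_lt hN h k.2

theorem two_pi_div_lt_pi {N : ℕ} (hN : 3 ≤ N) : 2 * Real.pi / N < Real.pi := by
  have hN3 : (3 : ℝ) ≤ N := by exact_mod_cast hN
  rw [div_lt_iff₀ (by linarith)]
  nlinarith [Real.pi_pos]

theorem Conf.IsNRing.mu_eq {N : ℕ} (hN : 3 ≤ N) {U : Conf N} (h : U.IsNRing) :
    U.mu = Real.cos (2 * Real.pi / N) := by
  obtain ⟨e, f, he, hf, hef, σ, hσ⟩ := h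
  have hσ' : ∀ k : Fin N, U.vec (σ k) = ringPoint N e f k := hσ
  refine le_antisymm (maxOffDiag_le (by omega) fun i j hij => ?_) ?_
  · obtain ⟨k, rfl⟩ := σ.surjective i
    obtain ⟨l, rfl⟩ := σ.surjective j
    rw [gramArray, hσ', hσ']
    exact inner_ringPoint_le (by omega) he hf hef fun h => hij (congrArg σ h)
  · have hne : (⟨0, by omega⟩ : Fin N) ≠ ⟨1, by omega⟩ := by simp
    have := le_maxOffDiag (gramArray U.vec) (σ.injective.ne hne)
    rw [gramArray, hσ', hσ', inner_ringPoint he hf hef] at this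
    simpa [Conf.mu] using this

theorem Conf.IsNRing.rho_eq {N : ℕ} (hN : 3 ≤ N) {U : Conf N} (h : U.IsNRing) :
    U.rho = Real.pi / N := by
  rw [Conf.rho_eq (by omega), h.mu_eq hN, Real.arccos_cos (by positivity) (two_pi_div_lt_pi hN).le]
  ring

/-- Rings are critical: with equal weights on the sides of the polygon, the sum of the inner
products of neighbours is stationary. -/
theorem Conf.IsNRing.isCritical {N : ℕ} (hN : 3 ≤ N) {U : Conf N} (h : U.IsNRing) :
    U.IsCritical := by
  intro v hv
  have hmu := h.mu_eq hN
  obtain ⟨e, f, he, hf, hef, σ, hσ⟩ := h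
  have hσ' : ∀ k : Fin N, U.vec (σ k) = ringPoint N e f k := hσ
  have : NeZero N := ⟨by omega⟩
  have hN0 : (0 : ℝ) < N := by exact_mod_cast (by omega : 0 < N)
  set c := Real.cos (2 * Real.pi / N) with hc
  have hper := periodic_ringPoint (N := N) (by omega) e f
  have hsucc : ∀ k : Fin N, U.vec (σ (k + 1)) = ringPoint N e f (k + 1) := fun k => by
    rw [hσ', Fin.val_add, Fin.val_one', Nat.add_mod_mod, hper.map_mod_nat]
  have hsucc2 : ∀ k : Fin N, U.vec (σ (k + 1 + 1)) = ringPoint N e f (k + 2) := fun k => by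
    rw [hsucc, ← hper.map_mod_nat, Fin.val_add, Fin.val_one', Nat.add_mod_mod, Nat.mod_add_mod,
      hper.map_mod_nat]
  have hside : ∀ k : Fin N, gramArray U.vec (σ k) (σ (k + 1)) = c := fun k => by
    rw [gramArray, hsucc, hσ', inner_ringPoint he hf hef, hc]
    push_cast
    congr 1
    ring
  have hderiv : ∑ k, gramDeriv U.vec v (σ k) (σ (k + 1)) = 0 := by
    simp only [gramDeriv, Finset.sum_add_distrib]
    rw [← Equiv.sum_comp (Equiv.addRight (1 : Fin N))
      (fun k => (inner ℝ (v (σ k)) (U.vec (σ (k + 1))) : ℝ)), ← Finset.sum_add_distrib]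
    refine Finset.sum_eq_zero fun k _ => ?_
    rw [Equiv.coe_addRight, real_inner_comm, ← inner_add_right, hσ', hsucc2,
      ringPoint_add_ringPoint, inner_smul_right, ← hsucc, real_inner_comm, hv, mul_zero]
  set K := ∑ k, (‖v (σ k)‖ ^ 2 + ‖v (σ (k + 1))‖ ^ 2) with hK
  -- the average over the sides decreases at second order only, and the maximum is no smaller
  have hmain : ∀ s, c - K / N * s ^ 2 ≤ maxOffDiag (gramArray (vary U.vec v s)) := fun s => by
    have h1 : ∑ k, gramArray (vary U.vec v s) (σ k) (σ (k + 1)) ≤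
        N * maxOffDiag (gramArray (vary U.vec v s)) := by
      have := Finset.sum_le_card_nsmul Finset.univ
        (fun k => gramArray (vary U.vec v s) (σ k) (σ (k + 1))) _
        fun k _ => le_maxOffDiag (gramArray (vary U.vec v s)) (σ.injective.ne (a₁ := k)
          (a₂ := k + 1) (by
            have : NeZero (1 : Fin N) := ⟨by
              rw [Ne, Fin.ext_iff, Fin.val_one', Nat.mod_eq_of_lt (by omega)]; simp⟩
            simp [NeZero.ne]))
      simpa using this
    have h2 : ∑ k, (c + s * gramDeriv U.vec v (σ k) (σ (k + 1)) -
        s ^ 2 * (‖v (σ k)‖ ^ 2 + ‖v (σ (k + 1))‖ ^ 2)) ≤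
        ∑ k, gramArray (vary U.vec v s) (σ k) (σ (k + 1)) := by
      refine Finset.sum_le_sum fun k _ => ?_
      have := (abs_le.1 (abs_gramArray_vary_sub_le U.norm_vec hv s (σ k) (σ (k + 1)))).1
      rw [hside] at this
      simp only [gramDeriv]
      linarith
    rw [Finset.sum_sub_distrib, Finset.sum_add_distrib, ← Finset.mul_sum, ← Finset.mul_sum, hderiv,
      ← hK] at h2
    simp only [Finset.sum_const, Finset.card_univ, Fintype.card_fin, nsmul_eq_mul] at h2
    have h3 := h2.trans h1
    have e1 : c - K / N * s ^ 2 = (N * c + s * 0 - s ^ 2 * K) / N := by field_simp; ring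
    rw [e1, div_le_iff₀ hN0]
    linarith
  have hc1 : c < 1 := hmu ▸ U.mu_lt_one (by omega)
  have hc2 : c ≠ -1 := by
    rw [hc, ← Real.cos_pi]
    exact (Real.cos_lt_cos_of_nonneg_of_le_pi (by positivity) le_rfl (two_pi_div_lt_pi hN)).ne'
  have hd : HasDerivAt (fun s : ℝ => Real.arccos (c - K / N * s ^ 2)) 0 0 := by
    have h1 : HasDerivAt (fun s : ℝ => c - K / N * s ^ 2) 0 0 := by
      simpa using ((hasDerivAt_pow 2 (0 : ℝ)).const_mul (K / N)).const_sub c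
    have h2 := Real.hasDerivAt_arccos (x := c - K / N * 0 ^ 2) (by simpa using hc2)
      (by simpa using hc1.ne)
    simpa [Function.comp_def] using h2.comp (0 : ℝ) h1
  have ho := hasDerivAt_iff_isLittleO_nhds_zero.1 hd
  simp only [zero_add, smul_zero, sub_zero, ne_eq, OfNat.ofNat_ne_zero, not_false_eq_true,
    zero_pow, mul_zero] at ho
  refine (Asymptotics.IsBigO.of_bound' (Filter.Eventually.of_forall fun s => ?_)).trans_isLittleO ho
  have h1 := Real.arccos_le_arccos (hmain s)
  rw [injRadius_eq (by omega) (norm_vary U.norm_vec hv s), Conf.rho_eq (by omega), hmu,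
    Real.norm_eq_abs, Real.norm_eq_abs, abs_of_nonneg (le_max_right _ _)]
  have h2 := le_abs_self (Real.arccos (c - K / N * s ^ 2) - Real.arccos c)
  have h3 := abs_nonneg (Real.arccos (c - K / N * s ^ 2) - Real.arccos c)
  exact max_le (by linarith) h3

/-! ### Existence of rings and uniqueness up to rotation and relabelling -/

theorem exists_isNRing {N : ℕ} (hN : 3 ≤ N) : ∃ U : Conf N, U.IsNRing := by
  let e : E3 := EuclideanSpace.single 0 1
  let f : E3 := EuclideanSpace.single 1 1
  have he : ‖e‖ = 1 := by simp [e]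
  have hf : ‖f‖ = 1 := by simp [f]
  have hef : inner ℝ e f = (0 : ℝ) := by simp [e, f, EuclideanSpace.inner_single_left]
  have hunit : ∀ k, ‖ringPoint N e f k‖ = 1 := fun k => norm_cos_smul_add_sin_smul he hf hef _
  refine ⟨⟨fun k => ⟨ringPoint N e f k, by simp [hunit]⟩, fun k l hkl => ?_⟩,
    e, f, he, hf, hef, Equiv.refl _, fun k => rfl⟩
  by_contra hne
  have h1 := inner_ringPoint_le (by omega) he hf hef hne
  have h2 : ringPoint N e f k = ringPoint N e f l := congrArg Subtype.val hkl
  rw [← h2, real_inner_self_eq_norm_sq, hunit, one_pow] at h1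
  have h3 := Real.cos_lt_cos_of_nonneg_of_le_pi le_rfl (two_pi_div_lt_pi hN).le
    (by have : (0 : ℝ) < N := by exact_mod_cast (by omega : 0 < N)
        positivity)
  rw [Real.cos_zero] at h3
  linarith

/-- An orthonormal pair is rotated to the first two coordinate vectors, by the matrix with rows
`e`, `f`, `e × f`. -/
theorem exists_rot_to_standard {e f : E3} (he : ‖e‖ = 1) (hf : ‖f‖ = 1) (hef : inner ℝ e f = 0) :
    ∃ A : SO3, rot A e = EuclideanSpace.single 0 1 ∧ rot A f = EuclideanSpace.single 1 1 := by
  have h1 : e 0 * e 0 + e 1 * e 1 + e 2 * e 2 = 1 := by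
    have := EuclideanSpace.real_norm_sq_eq e
    rw [he, Fin.sum_univ_three] at this
    linarith
  have h2 : f 0 * f 0 + f 1 * f 1 + f 2 * f 2 = 1 := by
    have := EuclideanSpace.real_norm_sq_eq f
    rw [hf, Fin.sum_univ_three] at this
    linarith
  have h3 : e 0 * f 0 + e 1 * f 1 + e 2 * f 2 = 0 := by
    simp [PiLp.inner_apply, Fin.sum_univ_three] at hef
    linarith
  let M : Matrix (Fin 3) (Fin 3) ℝ := !![e 0, e 1, e 2; f 0, f 1, f 2;
    e 1 * f 2 - e 2 * f 1, e 2 * f 0 - e 0 * f 2, e 0 * f 1 - e 1 * f 0]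
  have hcross : (e 1 * f 2 - e 2 * f 1) * (e 1 * f 2 - e 2 * f 1) +
      (e 2 * f 0 - e 0 * f 2) * (e 2 * f 0 - e 0 * f 2) +
      (e 0 * f 1 - e 1 * f 0) * (e 0 * f 1 - e 1 * f 0) = 1 := by
    linear_combination (f 0 * f 0 + f 1 * f 1 + f 2 * f 2) * h1 + h2 -
      (e 0 * f 0 + e 1 * f 1 + e 2 * f 2) * h3
  have hMM : M * M.transpose = 1 := by
    ext i j
    fin_cases i <;> fin_cases j <;>
      simp [M, Matrix.mul_apply, Fin.sum_univ_three] <;> linarith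
  have hdet : M.det = 1 := by
    rw [Matrix.det_fin_three]
    simp [M]
    linarith
  refine ⟨⟨M, Matrix.mem_specialOrthogonalGroup_iff.2
    ⟨(Matrix.mem_orthogonalGroup_iff _ _).2 hMM, hdet⟩⟩, ?_, ?_⟩
  · ext i
    fin_cases i <;> simp [rot, Matrix.toLpLin_apply, M, dotProduct,
      Fin.sum_univ_three] <;> linarith
  · ext i
    fin_cases i <;> simp [rot, Matrix.toLpLin_apply, M, dotProduct,
      Fin.sum_univ_three] <;> linarith

theorem Conf.IsNRing.exists_relabel_eq {N : ℕ} {U W : Conf N} (hU : U.IsNRing) (hW : W.IsNRing) :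
    ∃ σ : Equiv.Perm (Fin N), BConf.mk (U.relabel σ) = BConf.mk W := by
  obtain ⟨e, f, he, hf, hef, σ, hσ⟩ := hU
  obtain ⟨e', f', he', hf', hef', τ, hτ⟩ := hW
  obtain ⟨A, hAe, hAf⟩ := exists_rot_to_standard he hf hef
  obtain ⟨A', hAe', hAf'⟩ := exists_rot_to_standard he' hf' hef'
  refine ⟨τ.symm.trans σ, Quotient.sound (s := MulAction.orbitRel SO3 (Conf N))
    ⟨A⁻¹ * A', Subtype.ext (funext fun i => Subtype.ext ?_)⟩⟩
  change rot (A⁻¹ * A') (W.vec i) = U.vec (σ (τ.symm i))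
  obtain ⟨k, rfl⟩ := τ.surjective i
  rw [Equiv.symm_apply_apply, hσ, hτ, rot_mul]
  simp only [map_add, map_smul, hAe', hAf']
  rw [← hAe, ← hAf, rot_inv_rot, rot_inv_rot]

theorem isLeast_criticalValue {N : ℕ} (hN : 3 ≤ N) :
    IsLeast {c : ℝ | IsCriticalValue N c} (Real.pi / N) := by
  refine ⟨?_, ?_⟩
  · obtain ⟨U, hU⟩ := exists_isNRing hN
    exact ⟨BConf.mk U, hU.isCritical hN, hU.rho_eq hN⟩
  · rintro c ⟨x, hx, rfl⟩
    obtain ⟨U, rfl⟩ := Quotient.exists_rep x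
    obtain ⟨w, hw, hw0⟩ := Conf.IsCritical.exists_stress (by omega) (U := U) hx
    by_contra! h
    have h' : U.rho < Real.pi / N := h
    exact h'.ne (Conf.isNRing_of_stress hN hw hw0 h'.le).1

theorem isCritical_and_rho_eq_iff {N : ℕ} (hN : 3 ≤ N) (U : Conf N) :
    ((BConf.mk U).IsCritical ∧ (BConf.mk U).rho = Real.pi / N) ↔ U.IsNRing := by
  refine ⟨fun ⟨hc, hr⟩ => ?_, fun h => ⟨h.isCritical hN, h.rho_eq hN⟩⟩
  obtain ⟨w, hw, hw0⟩ := Conf.IsCritical.exists_stress (by omega) (U := U) hc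
  exact (Conf.isNRing_of_stress hN hw hw0 hr.le).2

/-! ### A continuous equivariant field that increases the smallest angles -/

/-- The tangent field with coefficients `α`: at the `i`-th point, a combination of the directions
towards the other points. -/
noncomputable def coeffField {N : ℕ} (u : Fin N → E3) (α : Fin N → Fin N → ℝ) (i : Fin N) : E3 :=
  ∑ k, α i k • (u k - (inner ℝ (u i) (u k) : ℝ) • u i)

/-- The derivative of the inner products along `coeffField`, in terms of the Gram matrix. -/
noncomputable def coeffDeriv {N : ℕ} (M α : Fin N → Fin N → ℝ) (i j : Fin N) : ℝ :=
  ∑ k, α j k * (M i k - M j k * M i j) + ∑ k, α i k * (M k j - M i k * M i j)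

theorem isTangent_coeffField {N : ℕ} {u : Fin N → E3} (hu : ∀ i, ‖u i‖ = 1)
    (α : Fin N → Fin N → ℝ) : IsTangent u (coeffField u α) := fun i => by
  simp [coeffField, inner_sum, inner_smul_right, inner_sub_right, hu]

theorem gramDeriv_coeffField {N : ℕ} (u : Fin N → E3) (α : Fin N → Fin N → ℝ) (i j : Fin N) :
    gramDeriv u (coeffField u α) i j = coeffDeriv (gramArray u) α i j := by
  simp only [gramDeriv, coeffDeriv, coeffField, gramArray, inner_sum, sum_inner, inner_smul_right,
    inner_smul_left, inner_sub_right, inner_sub_left, conj_trivial]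

theorem coeffField_rot {N : ℕ} (A : SO3) (u : Fin N → E3) (α : Fin N → Fin N → ℝ) (i : Fin N) :
    coeffField (fun i => rot A (u i)) α i = rot A (coeffField u α i) := by
  simp only [coeffField, inner_rot, map_sum, map_smul, map_sub]

/-- Projecting a tangent field to the linear span of the points does not affect the derivatives of
the inner products, so only fields of the form `coeffField` need to be considered. -/
theorem exists_coeffField {N : ℕ} {u v : Fin N → E3} (hv : IsTangent u v) :
    ∃ α : Fin N → Fin N → ℝ, ∀ i j, gramDeriv u (coeffField u α) i j = gramDeriv u v i j := by
  have key : ∀ i, ∃ a : Fin N → ℝ, ∀ j,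
      inner ℝ (∑ k, a k • u k) (u j) = (inner ℝ (v i) (u j) : ℝ) := fun i => by
      let S := Submodule.span ℝ (Set.range u)
      have h1 : S.starProjection (v i) ∈ S := S.starProjection_apply_mem _
      obtain ⟨a, ha⟩ := (Submodule.mem_span_range_iff_exists_fun ℝ).1 h1
      refine ⟨a, fun j => ?_⟩
      rw [ha]
      have h2 : u j ∈ S := Submodule.subset_span ⟨j, rfl⟩
      have := S.starProjection_inner_eq_zero (v i) (u j) h2
      rw [inner_sub_left] at this
      linarith
  choose α hα using key
  have h : ∀ i j, inner ℝ (coeffField u α i) (u j) = (inner ℝ (v i) (u j) : ℝ) := fun i j => by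
    have h1 : coeffField u α i = ∑ k, α i k • u k - (inner ℝ (∑ k, α i k • u k) (u i) : ℝ) • u i := by
      rw [real_inner_comm]
      simp only [coeffField, smul_sub, Finset.sum_sub_distrib, smul_smul, ← Finset.sum_smul,
        inner_sum, inner_smul_right]
    have h2 : (inner ℝ (v i) (u i) : ℝ) = 0 := by rw [real_inner_comm, hv i]
    rw [h1, inner_sub_left, hα i j, hα i i, h2]
    simp
  refine ⟨α, fun i j => ?_⟩
  rw [gramDeriv, gramDeriv, h i j, real_inner_comm, h j i, real_inner_comm]

theorem continuous_coeffDeriv {N : ℕ} (α : Fin N → Fin N → ℝ) (i j : Fin N) :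
    Continuous fun M => coeffDeriv M α i j := by
  unfold coeffDeriv
  fun_prop

theorem coeffDeriv_comb {N : ℕ} (M α α' : Fin N → Fin N → ℝ) (a b : ℝ) (i j : Fin N) :
    coeffDeriv M (a • α + b • α') i j = a * coeffDeriv M α i j + b * coeffDeriv M α' i j := by
  simp only [coeffDeriv, Pi.add_apply, Pi.smul_apply, smul_eq_mul, add_mul, Finset.sum_add_distrib,
    mul_add, Finset.mul_sum, mul_assoc]
  ring

theorem Conf.continuous_vec (N : ℕ) : Continuous (Conf.vec : Conf N → Fin N → E3) :=
  continuous_pi fun i =>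
    continuous_subtype_val.comp ((continuous_apply i).comp continuous_subtype_val)

theorem Conf.isInducing_vec (N : ℕ) : Topology.IsInducing (Conf.vec : Conf N → Fin N → E3) :=
  (Topology.IsInducing.piMap fun _ : Fin N => Topology.IsInducing.subtypeVal
    (t := Metric.sphere (0 : E3) 1)).comp Topology.IsInducing.subtypeVal

theorem continuous_gramArray (N : ℕ) : Continuous (gramArray : (Fin N → E3) → Fin N → Fin N → ℝ) := by
  unfold gramArray
  fun_prop

theorem Conf.continuous_mu {N : ℕ} (hN : 2 ≤ N) : Continuous (Conf.mu : Conf N → ℝ) :=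
  (continuous_maxOffDiag hN).comp ((continuous_gramArray N).comp (Conf.continuous_vec N))

theorem Conf.gramArray_smul {N : ℕ} (A : SO3) (U : Conf N) :
    gramArray (A • U).vec = gramArray U.vec := by
  funext i j
  exact inner_rot A _ _

theorem Conf.mu_smul {N : ℕ} (A : SO3) (U : Conf N) : (A • U).mu = U.mu := by
  rw [Conf.mu, Conf.gramArray_smul, Conf.mu]

/-- Below the ring value there are no stresses, so the closest pairs can be pulled apart. -/
theorem Conf.exists_coeff {N : ℕ} (hN : 3 ≤ N) {U : Conf N}
    (hU : Real.cos (2 * Real.pi / N) < U.mu) :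
    ∃ α κ L, 0 < κ ∧ 0 < L ∧ ∀ i j, i ≠ j →
      coeffDeriv (gramArray U.vec) α i j + κ < L * (U.mu - gramArray U.vec i j) := by
  have hlt : U.rho < Real.pi / N := by
    rw [Conf.rho_eq (by omega)]
    have h1 : Real.arccos U.mu < Real.arccos (Real.cos (2 * Real.pi / N)) :=
      Real.arccos_lt_arccos (Real.neg_one_le_cos _) hU (U.mu_lt_one (by omega)).le
    rw [Real.arccos_cos (by positivity) (two_pi_div_lt_pi hN).le] at h1
    have h2 : 2 * Real.pi / N = 2 * (Real.pi / N) := by ring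
    linarith
  obtain ⟨v, hv, hD⟩ := exists_expanding_of_no_stress U.norm_vec (c := U.mu) fun w hw => by
    by_contra hw0
    exact hlt.ne (Conf.isNRing_of_stress hN hw hw0 hlt.le).1
  obtain ⟨α, hα⟩ := exists_coeffField hv
  obtain ⟨κ, hκ, L, hL, h⟩ := exists_rate (M := gramArray U.vec)
    (D := coeffDeriv (gramArray U.vec) α) fun i j hij he => by
      rw [← gramDeriv_coeffField, hα]
      exact hD i j hij he
  exact ⟨α, κ, L, hκ, hL, h⟩

/-- A continuous choice of the coefficients of an expanding field, by convexity. The coefficients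
are functions on the space of Gram matrices, so that they are invariant under rotations. -/
theorem exists_continuous_coeff {N : ℕ} (hN : 3 ≤ N) {β : ℝ} (hβ : Real.cos (2 * Real.pi / N) < β) :
    ∃ g : C(Set.range fun U : Conf N => gramArray U.vec, (Fin N → Fin N → ℝ) × ℝ × ℝ),
      ∀ M, 0 < (g M).2.1 ∧ 0 < (g M).2.2 ∧ (β ≤ maxOffDiag M.1 → ∀ i j, i ≠ j →
        coeffDeriv M.1 (g M).1 i j + (g M).2.1 < (g M).2.2 * (maxOffDiag M.1 - M.1 i j)) := by
  refine exists_continuous_forall_mem_convex_of_local_const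
    (X := Set.range fun U : Conf N => gramArray U.vec)
    (t := fun M => {p : (Fin N → Fin N → ℝ) × ℝ × ℝ | 0 < p.2.1 ∧ 0 < p.2.2 ∧
      (β ≤ maxOffDiag M.1 → ∀ i j, i ≠ j →
        coeffDeriv M.1 p.1 i j + p.2.1 < p.2.2 * (maxOffDiag M.1 - M.1 i j))})
    (fun M => ?_) fun ⟨M, U, hU⟩ => ?_
  · rintro ⟨α, κ, L⟩ ⟨h1, h2, h3⟩ ⟨α', κ', L'⟩ ⟨h1', h2', h3'⟩ a b ha hb hab
    have hpos : ∀ {x y : ℝ}, 0 < x → 0 < y → 0 < a * x + b * y := fun {x y} hx hy => by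
      rcases ha.eq_or_lt with rfl | ha'
      · have : b = 1 := by linarith
        simpa [this] using hy
      · have := mul_pos ha' hx
        have := mul_nonneg hb hy.le
        linarith
    refine ⟨hpos h1 h1', hpos h2 h2', fun hM i j hij => ?_⟩
    have e1 := sub_pos.2 (h3 hM i j hij)
    have e2 := sub_pos.2 (h3' hM i j hij)
    have e3 := hpos e1 e2
    simp only [Prod.smul_mk, Prod.mk_add_mk, smul_eq_mul, coeffDeriv_comb]
    linarith
  · have hU' : gramArray U.vec = M := hU
    have hmax : Continuous fun M : Set.range fun U : Conf N => gramArray U.vec => maxOffDiag M.1 :=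
      (continuous_maxOffDiag (by omega)).comp continuous_subtype_val
    rcases lt_or_ge (maxOffDiag M) β with hM | hM
    · refine ⟨(0, 1, 1), ?_⟩
      filter_upwards [hmax.continuousAt.eventually_lt continuousAt_const hM] with M' hM'
      exact ⟨one_pos, one_pos, fun h => absurd h (not_le.2 hM')⟩
    · obtain ⟨α, κ, L, hκ, hL, h⟩ := Conf.exists_coeff hN (U := U)
        (by rw [Conf.mu, hU']; exact hβ.trans_le hM)
      refine ⟨(α, κ, L), ?_⟩
      have : ∀ᶠ M' : Set.range fun U : Conf N => gramArray U.vec in 𝓝 ⟨M, U, hU⟩,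
          ∀ i j, i ≠ j → coeffDeriv M'.1 α i j + κ < L * (maxOffDiag M'.1 - M'.1 i j) := by
        simp only [Filter.eventually_all]
        intro i j hij
        have h1 := h i j hij
        rw [Conf.mu, hU'] at h1
        refine ContinuousAt.eventually_lt
          (((continuous_coeffDeriv α i j).comp continuous_subtype_val).add
            continuous_const).continuousAt
          (continuous_const.mul (hmax.sub ((continuous_apply j).comp
            ((continuous_apply i).comp continuous_subtype_val)))).continuousAt h1
      filter_upwards [this] with M' hM'
      exact ⟨hκ, hL, fun _ => hM'⟩

/-- A continuous equivariant tangent field along which the cosine of the smallest angle decreases at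
least at rate `δ` up to time `1`, as long as it is at least `β`. -/
theorem exists_expanding_field {N : ℕ} (hN : 3 ≤ N) {β : ℝ}
    (hβ : Real.cos (2 * Real.pi / N) < β) :
    ∃ (V : Conf N → Fin N → E3) (δ : Conf N → ℝ), Continuous V ∧ Continuous δ ∧
      (∀ U, IsTangent U.vec (V U)) ∧ (∀ U, 0 < δ U) ∧
      (∀ (A : SO3) U, V (A • U) = fun i => rot A (V U i)) ∧ (∀ (A : SO3) U, δ (A • U) = δ U) ∧
      ∀ U, β ≤ U.mu → ∀ s, 0 ≤ s → s ≤ 1 →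
        maxOffDiag (gramArray (vary U.vec (V U) s)) ≤ U.mu - s * δ U := by
  obtain ⟨g, hg⟩ := exists_continuous_coeff hN hβ
  let G : Conf N → Set.range fun U : Conf N => gramArray U.vec := fun U => ⟨_, U, rfl⟩
  have hG : Continuous G :=
    ((continuous_gramArray N).comp (Conf.continuous_vec N)).subtype_mk _
  have hGA : ∀ (A : SO3) U, G (A • U) = G U := fun A U => Subtype.ext (Conf.gramArray_smul A U)
  let V₀ : Conf N → Fin N → E3 := fun U => coeffField U.vec (g (G U)).1
  let κ : Conf N → ℝ := fun U => (g (G U)).2.1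
  let L : Conf N → ℝ := fun U => (g (G U)).2.2
  let B : Conf N → ℝ := fun U => 1 + 2 * ∑ i, ‖V₀ U i‖ ^ 2
  let r : Conf N → ℝ := fun U => min (1 / L U) (κ U / 2 / B U)
  have hgc : Continuous fun U => g (G U) := g.continuous.comp hG
  have hvec := Conf.continuous_vec N
  have hV₀ : Continuous V₀ := by
    refine continuous_pi fun i => ?_
    simp only [V₀, coeffField]
    have h1 : ∀ k, Continuous fun U : Conf N => U.vec k := fun k => (continuous_apply k).comp hvec
    have h2 : ∀ i k, Continuous fun U : Conf N => (g (G U)).1 i k := fun i k =>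
      (continuous_apply k).comp ((continuous_apply i).comp (continuous_fst.comp hgc))
    fun_prop
  have hκ : Continuous κ := continuous_fst.comp (continuous_snd.comp hgc)
  have hL : Continuous L := continuous_snd.comp (continuous_snd.comp hgc)
  have hBpos : ∀ U, 0 < B U := fun U => by
    have : 0 ≤ ∑ i, ‖V₀ U i‖ ^ 2 := Finset.sum_nonneg fun i _ => sq_nonneg _
    simp only [B]
    linarith
  have hB : Continuous B := by
    simp only [B]
    exact continuous_const.add (continuous_const.mul (continuous_finsetSum _ fun i _ =>
      (((continuous_apply i).comp hV₀).norm.pow 2)))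
  have hκpos : ∀ U, 0 < κ U := fun U => (hg (G U)).1
  have hLpos : ∀ U, 0 < L U := fun U => (hg (G U)).2.1
  have hr : Continuous r := (continuous_const.div₀ hL fun U => (hLpos U).ne').min
    ((hκ.div_const 2).div₀ hB fun U => (hBpos U).ne')
  have hrpos : ∀ U, 0 < r U := fun U => lt_min (one_div_pos.2 (hLpos U))
    (div_pos (half_pos (hκpos U)) (hBpos U))
  have hV₀A : ∀ (A : SO3) U, V₀ (A • U) = fun i => rot A (V₀ U i) := fun A U => by
    funext i
    simp only [V₀, hGA]
    exact coeffField_rot A U.vec _ i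
  have hrA : ∀ (A : SO3) U, r (A • U) = r U := fun A U => by
    simp only [r, κ, L, B, hV₀A, hGA, norm_rot]
  have htan : ∀ U, IsTangent U.vec (V₀ U) := fun U => isTangent_coeffField U.norm_vec _
  refine ⟨fun U i => r U • V₀ U i, fun U => r U * (κ U / 2), ?_, hr.mul (hκ.div_const 2),
    fun U i => by rw [inner_smul_right, htan U i, mul_zero],
    fun U => mul_pos (hrpos U) (half_pos (hκpos U)), fun A U => ?_, fun A U => ?_,
    fun U hU s hs0 hs1 => ?_⟩
  · exact continuous_pi fun i => hr.smul ((continuous_apply i).comp hV₀)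
  · funext i
    simp only [hrA, hV₀A, map_smul]
  · simp only [hrA, κ, hGA]
  · have hvary : vary U.vec (fun i => r U • V₀ U i) s = vary U.vec (V₀ U) (s * r U) := by
      funext i
      simp only [vary, smul_smul]
    have hsr : s * r U ≤ r U := mul_le_of_le_one_left (hrpos U).le hs1
    have h := maxOffDiag_vary_le (κ := κ U) (L := L U) (B := B U) (s := s * r U) (by omega)
      U.norm_vec (htan U) (fun i j hij => by
        rw [gramDeriv_coeffField]
        exact ((hg (G U)).2.2 hU i j hij).le)
      (fun i j => by
        have h1 := Finset.single_le_sum (f := fun i => ‖V₀ U i‖ ^ 2) (fun i _ => sq_nonneg _)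
          (Finset.mem_univ i)
        have h2 := Finset.single_le_sum (f := fun i => ‖V₀ U i‖ ^ 2) (fun i _ => sq_nonneg _)
          (Finset.mem_univ j)
        simp only [B]
        linarith)
      (mul_nonneg hs0 (hrpos U).le)
      ((le_div_iff₀ (hLpos U)).1 (hsr.trans (min_le_left _ _)))
      ((le_div_iff₀ (hBpos U)).1 (hsr.trans (min_le_right _ _)))
    rw [hvary]
    refine h.trans (le_of_eq ?_)
    rw [Conf.mu]
    ring

/-! ### The deformation retraction -/

/-- The configuration with given unit vectors. -/
def Conf.ofVec {N : ℕ} (u : Fin N → E3) (hu : ∀ i, ‖u i‖ = 1)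
    (h : ∀ i j, i ≠ j → gramArray u i j < 1) : Conf N :=
  ⟨fun i => ⟨u i, by simp [hu]⟩, fun i j hij => by
    by_contra hne
    have h1 : u i = u j := congrArg Subtype.val hij
    have h2 := h i j hne
    rw [gramArray, ← h1, real_inner_self_eq_norm_sq, hu, one_pow] at h2
    exact lt_irrefl _ h2⟩

theorem Conf.vec_injective (N : ℕ) : Function.Injective (Conf.vec : Conf N → Fin N → E3) :=
  fun _ _ h => Subtype.ext (funext fun i => Subtype.ext (congrFun h i))

theorem Conf.isCompact_mu_le {N : ℕ} (hN : 2 ≤ N) {m : ℝ} (hm : m < 1) :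
    IsCompact {U : Conf N | U.mu ≤ m} := by
  let S : Set (Fin N → E3) := {u | (∀ i, u i ∈ Metric.sphere (0 : E3) 1) ∧
    maxOffDiag (gramArray u) ≤ m}
  have hS : IsCompact S := by
    have h1 : IsCompact {u : Fin N → E3 | ∀ i, u i ∈ Metric.sphere (0 : E3) 1} :=
      isCompact_pi_infinite fun _ => isCompact_sphere _ _
    exact h1.inter_right (isClosed_le ((continuous_maxOffDiag hN).comp (continuous_gramArray N))
      continuous_const)
  have himg : Conf.vec '' {U : Conf N | U.mu ≤ m} = S := by
    ext u
    constructor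
    · rintro ⟨U, hU, rfl⟩
      exact ⟨fun i => by simp [U.norm_vec], hU⟩
    · rintro ⟨h1, h2⟩
      exact ⟨Conf.ofVec u (fun i => by simpa using h1 i) fun i j hij =>
        (le_maxOffDiag _ hij).trans_lt (h2.trans_lt hm), h2, rfl⟩
  rw [(Conf.isInducing_vec N).isCompact_iff, himg]
  exact hS

theorem vary_zero {N : ℕ} {u : Fin N → E3} (hu : ∀ i, ‖u i‖ = 1) (v : Fin N → E3) :
    vary u v 0 = u := by
  funext i
  simp [vary, hu]

/-- A map of the configuration space which fixes the configurations with `μ ≤ β` and decreases `μ`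
by a positive continuous amount, but not necessarily beyond `β`, reaches them within a locally
bounded number of iterations. -/
theorem exists_iterate_mu_le {N : ℕ} (hN : 2 ≤ N) {β : ℝ} (g : Conf N → Conf N)
    {δ : Conf N → ℝ} (hδ : Continuous δ) (hδ0 : ∀ U, 0 < δ U)
    (hfix : ∀ U : Conf N, U.mu ≤ β → g U = U)
    (hdec : ∀ U : Conf N, (g U).mu ≤ max β (U.mu - δ U)) (U : Conf N) :
    ∃ n : ℕ, ∀ᶠ W in 𝓝 U, (g^[n] W).mu ≤ β := by
  have hmu := Conf.continuous_mu (N := N) hN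
  obtain ⟨m, hUm, hm1⟩ := exists_between (U.mu_lt_one hN)
  -- on the compact set `{μ ≤ m}` each step gains at least `ε`
  obtain ⟨ε, hε, hεδ⟩ : ∃ ε > 0, ∀ W : Conf N, W.mu ≤ m → ε ≤ δ W := by
    obtain ⟨W, -, hW⟩ := (Conf.isCompact_mu_le hN hm1).exists_isMinOn
      ⟨U, hUm.le⟩ hδ.continuousOn
    exact ⟨δ W, hδ0 W, fun W' hW' => hW hW'⟩
  have hiter : ∀ W : Conf N, W.mu ≤ m → ∀ n : ℕ, (g^[n] W).mu ≤ max β (m - n * ε) := by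
    intro W hWm n
    induction n with
    | zero => simpa using Or.inr hWm
    | succ n ih =>
      rw [Function.iterate_succ_apply']
      generalize g^[n] W = W' at ih
      rcases le_or_gt W'.mu β with hW' | hW'
      · rw [hfix W' hW']
        exact hW'.trans (le_max_left _ _)
      · have h1 : W'.mu ≤ m - n * ε := (le_max_iff.1 ih).resolve_left hW'.not_ge
        have h2 := mul_nonneg (Nat.cast_nonneg (α := ℝ) n) hε.le
        have h3 := hεδ W' (by linarith)
        refine (hdec W').trans (max_le_max le_rfl ?_)
        push_cast
        linarith
  obtain ⟨n, hn⟩ := exists_nat_gt ((m - β) / ε)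
  rw [div_lt_iff₀ hε] at hn
  refine ⟨n, ?_⟩
  filter_upwards [hmu.continuousAt.eventually_lt continuousAt_const hUm] with W hW
  exact (hiter W hW.le n).trans (max_le le_rfl (by linarith))

/-- The flow along the expanding field, for the time needed to get from `μ` down to `β` but at
most for time one. -/
theorem exists_flow_step {N : ℕ} (hN : 3 ≤ N) {β : ℝ} (hβ : Real.cos (2 * Real.pi / N) < β) :
    ∃ (h : C(unitInterval × Conf N, Conf N)) (δ : Conf N → ℝ), Continuous δ ∧ (∀ U, 0 < δ U) ∧
      (∀ U, h (0, U) = U) ∧ (∀ t, ∀ U : Conf N, U.mu ≤ β → h (t, U) = U) ∧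
      (∀ U : Conf N, (h (1, U)).mu ≤ max β (U.mu - δ U)) ∧
      ∀ t (A : SO3) U, h (t, A • U) = A • h (t, U) := by
  have hN2 : 2 ≤ N := by omega
  obtain ⟨V, δ, hV, hδ, htan, hδ0, hVA, hδA, hdec⟩ := exists_expanding_field hN hβ
  have hmu := Conf.continuous_mu (N := N) hN2
  obtain ⟨r, hr, hr0, hr1, hrfix, hrdec, hrA⟩ : ∃ r : Conf N → ℝ, Continuous r ∧ (∀ U, 0 ≤ r U) ∧
      (∀ U, r U ≤ 1) ∧ (∀ U : Conf N, U.mu ≤ β → r U = 0) ∧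
      (∀ U : Conf N, β ≤ U.mu → U.mu - r U * δ U ≤ max β (U.mu - δ U)) ∧
      ∀ (A : SO3) U, r (A • U) = r U := by
    refine ⟨fun U => min 1 (max 0 ((U.mu - β) / δ U)), ?_, fun U => ?_, fun U => ?_,
      fun U hU => ?_, fun U hU => ?_, fun A U => ?_⟩
    · exact continuous_const.min (continuous_const.max
        ((hmu.sub continuous_const).div₀ hδ fun U => (hδ0 U).ne'))
    · exact le_min zero_le_one (le_max_left _ _)
    · exact min_le_left _ _
    · dsimp only
      rw [max_eq_left (div_nonpos_of_nonpos_of_nonneg (by linarith) (hδ0 U).le)]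
      simp
    · have hq : 0 ≤ (U.mu - β) / δ U := div_nonneg (by linarith) (hδ0 U).le
      dsimp only
      rw [max_eq_right hq]
      rcases le_total 1 ((U.mu - β) / δ U) with h | h
      · rw [min_eq_left h, one_mul]
        exact le_max_right _ _
      · rw [min_eq_right h, div_mul_cancel₀ _ (hδ0 U).ne']
        exact (by linarith : _ ≤ β).trans (le_max_left _ _)
    · simp only [hδA, Conf.mu_smul]
  obtain ⟨x, hx⟩ : ∃ x : unitInterval × Conf N → Fin N → E3,
      ∀ p, x p = vary p.2.vec (V p.2) (p.1 * r p.2) := ⟨_, fun p => rfl⟩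
  have hx1 : ∀ p i, ‖x p i‖ = 1 := fun p => by
    rw [hx]
    exact norm_vary p.2.norm_vec (htan p.2) _
  have hxfix : ∀ p : unitInterval × Conf N, p.2.mu ≤ β → x p = p.2.vec := fun p hp => by
    rw [hx, hrfix _ hp, mul_zero]
    exact vary_zero p.2.norm_vec _
  have hxle : ∀ p : unitInterval × Conf N, β ≤ p.2.mu →
      maxOffDiag (gramArray (x p)) ≤ p.2.mu - p.1 * r p.2 * δ p.2 := fun p hp => by
    rw [hx]
    exact hdec p.2 hp _ (mul_nonneg p.1.2.1 (hr0 _)) (mul_le_one₀ p.1.2.2 (hr0 _) (hr1 _))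
  have hxlt : ∀ p i j, i ≠ j → gramArray (x p) i j < 1 := fun p i j hij => by
    rcases le_total p.2.mu β with h | h
    · rw [hxfix p h]
      exact p.2.gramArray_lt_one hij
    · have h1 := (le_maxOffDiag (gramArray (x p)) hij).trans (hxle p h)
      have h2 := mul_nonneg (mul_nonneg p.1.2.1 (hr0 p.2)) (hδ0 p.2).le
      have h3 := p.2.mu_lt_one hN2
      linarith
  have hxc : Continuous x := by
    refine continuous_pi fun i => ?_
    have h1 : Continuous fun p : unitInterval × Conf N => p.2.vec i :=
      (continuous_apply i).comp ((Conf.continuous_vec N).comp continuous_snd)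
    have h2 : Continuous fun p : unitInterval × Conf N => V p.2 i :=
      (continuous_apply i).comp (hV.comp continuous_snd)
    have h3 : Continuous fun p : unitInterval × Conf N => (p.1 : ℝ) * r p.2 :=
      (continuous_subtype_val.comp continuous_fst).mul (hr.comp continuous_snd)
    have h4 := h1.add (h3.smul h2)
    have h5 := h4.norm.inv₀ fun p => (zero_lt_one.trans_le
      (one_le_norm_add_smul (p.2.norm_vec i) (htan p.2 i) ((p.1 : ℝ) * r p.2))).ne'
    exact (h5.smul h4).congr fun p => (congrFun (hx p) i).symm
  let h : C(unitInterval × Conf N, Conf N) :=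
    ⟨fun p => Conf.ofVec (x p) (hx1 p) (hxlt p), (Conf.isInducing_vec N).continuous_iff.2 hxc⟩
  have hvec : ∀ p, (h p).vec = x p := fun p => rfl
  have hfix : ∀ t U, U.mu ≤ β → h (t, U) = U := fun t U hU =>
    Conf.vec_injective N ((hvec _).trans (hxfix _ hU))
  clear_value h
  refine ⟨h, δ, hδ, hδ0, fun U => Conf.vec_injective N ?_, hfix, fun U => ?_,
    fun t A U => Conf.vec_injective N ?_⟩
  · rw [hvec, hx]
    simp only [Set.Icc.coe_zero, zero_mul]
    exact vary_zero U.norm_vec _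
  · rcases le_total U.mu β with hU | hU
    · rw [hfix 1 U hU]
      exact hU.trans (le_max_left _ _)
    · have h1 := hxle (1, U) hU
      rw [Set.Icc.coe_one, one_mul, ← hvec] at h1
      exact h1.trans (hrdec U hU)
  · rw [hvec, hx]
    simp only [hrA, hVA]
    refine (vary_rot A U.vec (V U) _).trans (funext fun i => ?_)
    rw [Conf.vec_smul, hvec, hx]

theorem mu_le_cos_iff {N : ℕ} (hN : 2 ≤ N) {θ : ℝ} (h0 : 0 ≤ θ) (hπ : θ ≤ Real.pi) (U : Conf N) :
    U.mu ≤ Real.cos θ ↔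
      ∀ i j : Fin N, i < j → θ ≤ InnerProductGeometry.angle (U.vec i) (U.vec j) := by
  have key : ∀ i j, θ ≤ InnerProductGeometry.angle (U.vec i) (U.vec j) ↔
      gramArray U.vec i j ≤ Real.cos θ := fun i j => by
    have h1 : gramArray U.vec i j =
        Real.cos (InnerProductGeometry.angle (U.vec i) (U.vec j)) :=
      inner_eq_cos_of_angle_eq (U.norm_vec i) (U.norm_vec j) rfl
    rw [h1]
    exact (Real.strictAntiOn_cos.le_iff_ge ⟨InnerProductGeometry.angle_nonneg _ _,
      InnerProductGeometry.angle_le_pi _ _⟩ ⟨h0, hπ⟩).symm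
  constructor
  · exact fun h i j hij => (key i j).2 ((le_maxOffDiag _ hij.ne).trans h)
  · refine fun h => maxOffDiag_le hN fun i j hij => ?_
    rcases lt_or_gt_of_ne hij with h1 | h1
    · exact (key i j).1 (h i j h1)
    · rw [gramArray, real_inner_comm]
      exact (key j i).1 (h j i h1)

/-- The equivariant deformation of the configuration space into the constrained one. -/
theorem exists_equivariant_deformation {N : ℕ} (hN : 3 ≤ N) {θ : ℝ} (h0 : 0 ≤ θ)
    (hθ : θ < 2 * Real.pi / N) :
    ∃ H : C(unitInterval × Conf N, Conf N), (∀ U, H (0, U) = U) ∧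
      (∀ U, H (1, U) ∈ Set.range (ConfAngle.incl N θ)) ∧
      (∀ t U, H (t, ConfAngle.incl N θ U) = ConfAngle.incl N θ U) ∧
      ∀ t (A : SO3) U, H (t, A • U) = A • H (t, U) := by
  have hπ := two_pi_div_lt_pi hN
  have hiff := fun U : Conf N => mu_le_cos_iff (by omega) h0 (hθ.trans hπ).le U
  obtain ⟨h, δ, hδ, hδ0, hh0, hhS, hdec, hA⟩ := exists_flow_step hN (β := Real.cos θ)
    (Real.cos_lt_cos_of_nonneg_of_le_pi h0 hπ.le hθ)
  obtain ⟨H, hH0, hH1, hHS, hHg⟩ := exists_homotopy_of_iterates h {U : Conf N | U.mu ≤ Real.cos θ}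
    hh0 hhS (exists_iterate_mu_le (by omega) _ hδ hδ0 (hhS 1) hdec)
  exact ⟨H, hH0, fun U => ⟨⟨_, (hiff _).1 (hH1 U)⟩, rfl⟩, fun t U => hHS t _ ((hiff _).2 U.2),
    fun t A U => hHg (A • ·) (fun t U => hA t A U) t U⟩

instance (N : ℕ) : ContinuousConstSMul SO3 (Conf N) where
  continuous_const_smul A := by
    refine (Conf.isInducing_vec N).continuous_iff.2 (continuous_pi fun i => ?_)
    have h1 : Continuous (rot A) := LinearMap.continuous_of_finiteDimensional _
    exact h1.comp ((continuous_apply i).comp (Conf.continuous_vec N))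

theorem isStrongDeformationRetract_incl {N : ℕ} (hN : 3 ≤ N) {θ : ℝ} (h0 : 0 ≤ θ)
    (hθ : θ < 2 * Real.pi / N) :
    IsStrongDeformationRetract (ConfAngle.incl N θ) ∧
      IsStrongDeformationRetract (BConfAngle.incl N θ) := by
  obtain ⟨H, hH0, hH1, hHfix, hHA⟩ := exists_equivariant_deformation hN h0 hθ
  have hemb : Topology.IsEmbedding (ConfAngle.incl N θ) := Topology.IsEmbedding.subtypeVal
  refine ⟨⟨hemb, H, hH0, hH1, hHfix⟩, ?_⟩
  obtain ⟨K, hK⟩ := exists_orbit_homotopy (G := SO3) H hHA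
  choose r hr using hH1
  have hrc : Continuous r := hemb.continuous_iff.2 (by
    rw [show ConfAngle.incl N θ ∘ r = fun U => H (1, U) from funext hr]
    fun_prop)
  have hrA : ∀ (A : SO3) U, r (A • U) = A • r U := fun A U => hemb.injective (by
    rw [hr, hHA]
    change _ = A • ConfAngle.incl N θ (r U)
    rw [hr])
  -- the retraction `r` descends to a left inverse `R` of the map between the orbit spaces
  let R : BConf N → BConfAngle N θ := Quotient.map (sa := MulAction.orbitRel SO3 (Conf N))
    (sb := MulAction.orbitRel SO3 (ConfAngle N θ)) r (by
      rintro U W ⟨A, rfl⟩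
      exact ⟨A, (hrA A W).symm⟩)
  have hRc : Continuous R := Continuous.quotient_map' (s := MulAction.orbitRel SO3 (Conf N))
    (t := MulAction.orbitRel SO3 (ConfAngle N θ)) hrc _
  have hRi : Function.LeftInverse R (BConfAngle.incl N θ) := by
    intro x
    obtain ⟨U, rfl⟩ := Quotient.exists_rep x
    exact congrArg (Quotient.mk (MulAction.orbitRel SO3 (ConfAngle N θ)))
      (hemb.injective ((hr _).trans (hHfix 1 U)))
  refine ⟨hRi.isEmbedding hRc (BConfAngle.incl N θ).continuous, K, fun x => ?_, fun x => ?_,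
    fun t x => ?_⟩
  · obtain ⟨U, rfl⟩ := Quotient.exists_rep x
    rw [hK, hH0]
  · obtain ⟨U, rfl⟩ := Quotient.exists_rep x
    exact ⟨Quotient.mk _ (r U), by rw [hK, ← hr]; rfl⟩
  · obtain ⟨U, rfl⟩ := Quotient.exists_rep x
    exact (hK t (ConfAngle.incl N θ U)).trans
      (congrArg (Quotient.mk (MulAction.orbitRel SO3 (Conf N))) (hHfix t U))

theorem theorem4p13 (N : ℕ) (hN : 3 ≤ N) :
    -- the smallest critical value is `π / N`
    IsLeast {c : ℝ | IsCriticalValue N c} (Real.pi / N) ∧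
    -- it is attained exactly at the `N`-rings
    (∀ U : Conf N, ((BConf.mk U).IsCritical ∧ (BConf.mk U).rho = Real.pi / N) ↔ U.IsNRing) ∧
    -- the `N`-ring is unique up to rotation and relabeling
    (∀ U W : Conf N, U.IsNRing → W.IsNRing →
      ∃ σ : Equiv.Perm (Fin N), BConf.mk (U.relabel σ) = BConf.mk W) ∧
    -- below the smallest critical value the topology is that of the full space
    ∀ θ : ℝ, 0 ≤ θ → θ < 2 * Real.pi / N →
      (IsStrongDeformationRetract (ConfAngle.incl N θ) ∧
        IsStrongDeformationRetract (BConfAngle.incl N θ)) ∧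
      (IsHomotopyEquivalence (ConfAngle.incl N θ) ∧
        InducesIsoOnCohomology (ConfAngle.incl N θ)) ∧
      (IsHomotopyEquivalence (BConfAngle.incl N θ) ∧
        InducesIsoOnCohomology (BConfAngle.incl N θ)) := by
  refine ⟨isLeast_criticalValue hN, isCritical_and_rho_eq_iff hN,
    fun U W hU hW => hU.exists_relabel_eq hW, fun θ h0 hθ => ?_⟩
  obtain ⟨h1, h2⟩ := isStrongDeformationRetract_incl hN h0 hθ
  have h3 := h1.isHomotopyEquivalence
  have h4 := h2.isHomotopyEquivalence
  exact ⟨⟨h1, h2⟩, ⟨h3, h3.inducesIsoOnCohomology⟩, h4, h4.inducesIsoOnCohomology⟩
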